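/- Let $R=\bigoplus_{n\in\mathbb Z}R_n$ be a $\mathbb Z$-graded ring that is right artinian (as an ungraded ring), and let $N$ be a finitely generated right $R$-module. A right $R$-module is called \emph{gradable} if it is isomorphic to the underlying $R$-module of a $\mathbb Z$-graded right $R$-module $M=\bigoplus_{n\in\mathbb Z} M_n$ (with $M_iR_j\subseteq M_{i+j}$ for all $i,j$). The \emph{pull-up} of $N$ is the graded right $R$-module $pN=\bigoplus_{n\in\mathbb Z}Ne_n$, where each $Ne_n$ is a copy of $N$, with $R$-action determined by $(xe_n)r=(xr)e_{n+j}$ for $x\in N$, $r\in R_j$; its underlying $R$-module is denoted $qpN$. A module is \emph{pure-projective} if it is isomorphic to a direct summand of a direct sum of finitely presented modules. Then the following conditions are equivalent: \begin{enumerate} \item $N$ is gradable; \item the pull-up $pN$ is pure-projective as a right $R$-module; \item $qpN\cong N^{(\omega)}$ as right $R$-modules, where $N^{(\omega)}$ is the direct sum of countably many copies of $N$. \end{enumerate} -/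

import Mathlib

/-!
Right modules over a ring `R` are modules over `Rᵐᵒᵖ`; the right action of `r : R` on `m` is
`MulOpposite.op r • m`.
-/

open DirectSum

universe u v w

/-- A family `ℳ` of additive subgroups of a right `R`-module `M` is a `ℤ`-grading of `M`, compatible
with the grading `𝓐` of `R`: `M = ⨁ₙ ℳ n` and `(ℳ i) (𝓐 j) ⊆ ℳ (i + j)`. -/
structure IsModuleGrading {R : Type u} [Ring R] (𝓐 : ℤ → AddSubgroup R)
    {M : Type w} [AddCommGroup M] [Module Rᵐᵒᵖ M] (ℳ : ℤ → AddSubgroup M) : Prop where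
  isInternal : DirectSum.IsInternal ℳ
  smul_mem : ∀ (i j : ℤ) (m : M) (r : R), m ∈ ℳ i → r ∈ 𝓐 j → MulOpposite.op r • m ∈ ℳ (i + j)

/-- A right `R`-module `N` is gradable if it is isomorphic to (the underlying module of) a
`ℤ`-graded right `R`-module `M`. -/
def IsGradable {R : Type u} [Ring R] (𝓐 : ℤ → AddSubgroup R)
    (N : Type v) [AddCommGroup N] [Module Rᵐᵒᵖ N] : Prop :=
  ∃ (M : Type v) (_ : AddCommGroup M) (_ : Module Rᵐᵒᵖ M) (ℳ : ℤ → AddSubgroup M),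
    IsModuleGrading 𝓐 ℳ ∧ Nonempty (N ≃ₗ[Rᵐᵒᵖ] M)

/-- A module is pure-projective if it is isomorphic to a direct summand of a direct sum of
finitely presented modules. (Every finitely presented `S`-module has a copy in the universe of `S`,
and only `max |M| ℵ₀` summands are needed, so the universes below lose no generality.) -/
def IsPureProjective (S : Type u) [Ring S] (M : Type w) [AddCommGroup M] [Module S M] : Prop :=
  ∃ (ι : Type w) (F : ι → Type u) (_ : ∀ k, AddCommGroup (F k)) (_ : ∀ k, Module S (F k)),
    (∀ k, Module.FinitePresentation S (F k)) ∧
      ∃ (i : M →ₗ[S] ⨁ k, F k) (s : (⨁ k, F k) →ₗ[S] M), s ∘ₗ i = LinearMap.id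

/-- The pull-up `pN = ⨁ₙ N eₙ` of a right `R`-module `N` (as an additive group); the element
`x eₙ` is `PullUp.of 𝓐 N n x`. The `R`-action, which depends on the grading `𝓐` of `R`, is
defined below; it is not the componentwise one. -/
def PullUp {R : Type u} [Ring R] (_𝓐 : ℤ → AddSubgroup R) (N : Type v) [AddCommGroup N] : Type v :=
  ⨁ _ : ℤ, N

namespace PullUp

noncomputable section

section Basic

variable {R : Type u} [Ring R] (𝓐 : ℤ → AddSubgroup R) (N : Type v) [AddCommGroup N]

instance : AddCommGroup (PullUp 𝓐 N) := inferInstanceAs (AddCommGroup (⨁ _ : ℤ, N))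

/-- `x ↦ x eₙ`. -/
def of (n : ℤ) : N →+ PullUp 𝓐 N := DirectSum.of (fun _ : ℤ => N) n

/-- The degree `n` component `N eₙ` of the pull-up. -/
def component (n : ℤ) : AddSubgroup (PullUp 𝓐 N) := (of 𝓐 N n).range

variable {𝓐 N} in
theorem hom_ext {G : Type*} [AddMonoid G] {f g : PullUp 𝓐 N →+ G}
    (h : ∀ n x, f (of 𝓐 N n x) = g (of 𝓐 N n x)) : f = g :=
  DirectSum.addHom_ext h

variable [Module Rᵐᵒᵖ N]

/-- The action of a homogeneous `r : 𝓐 j` on the pull-up: `x eₙ ↦ (x r) eₙ₊ⱼ`. -/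
def homogeneousAct (j : ℤ) (r : R) : PullUp 𝓐 N →+ PullUp 𝓐 N :=
  DirectSum.toAddMonoid fun n =>
    (of 𝓐 N (n + j)).comp (DistribSMul.toAddMonoidHom N (MulOpposite.op r))

theorem homogeneousAct_of (j : ℤ) (r : R) (n : ℤ) (x : N) :
    homogeneousAct 𝓐 N j r (of 𝓐 N n x) = of 𝓐 N (n + j) (MulOpposite.op r • x) :=
  DirectSum.toAddMonoid_of _ _ _

/-- The action of an arbitrary element of `R = ⨁ⱼ 𝓐 j`, by linear extension. -/
def act [GradedRing 𝓐] : R →+ PullUp 𝓐 N →+ PullUp 𝓐 N :=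
  (DirectSum.toAddMonoid fun j : ℤ =>
    AddMonoidHom.mk' (fun r : 𝓐 j => homogeneousAct 𝓐 N j r) fun r s => hom_ext fun n x => by
      simp [homogeneousAct_of, add_smul]).comp
    (DirectSum.decomposeAddEquiv 𝓐).toAddMonoidHom

theorem act_of [GradedRing 𝓐] {j : ℤ} {r : R} (hr : r ∈ 𝓐 j) (n : ℤ) (x : N) :
    act 𝓐 N r (of 𝓐 N n x) = of 𝓐 N (n + j) (MulOpposite.op r • x) := by
  simp [act, DirectSum.decompose_of_mem 𝓐 hr, homogeneousAct_of]

theorem act_one [GradedRing 𝓐] : act 𝓐 N 1 = AddMonoidHom.id _ :=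
  hom_ext fun n x => by simp [act_of 𝓐 N SetLike.GradedOne.one_mem]

theorem act_mul [GradedRing 𝓐] (r s : R) : act 𝓐 N (r * s) = (act 𝓐 N s).comp (act 𝓐 N r) := by
  induction r using DirectSum.Decomposition.inductionOn 𝓐 with
  | zero => simp
  | add a b ha hb => rw [add_mul, map_add, ha, hb, map_add, AddMonoidHom.comp_add]
  | homogeneous a =>
    induction s using DirectSum.Decomposition.inductionOn 𝓐 with
    | zero => simp
    | add a b ha hb => rw [mul_add, map_add, ha, hb, map_add, AddMonoidHom.add_comp]
    | homogeneous b =>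
      refine hom_ext fun n x => ?_
      rw [AddMonoidHom.comp_apply, act_of 𝓐 N (SetLike.mul_mem_graded a.2 b.2),
        act_of 𝓐 N a.2, act_of 𝓐 N b.2, MulOpposite.op_mul, mul_smul, add_assoc]

/-- The right `R`-module structure of the pull-up, determined by `(x eₙ) r = (x r) eₙ₊ⱼ` for
`r ∈ 𝓐 j`. -/
instance [GradedRing 𝓐] : Module Rᵐᵒᵖ (PullUp 𝓐 N) where
  smul r y := act 𝓐 N r.unop y
  one_smul y := DFunLike.congr_fun (act_one 𝓐 N) y
  mul_smul r s y := DFunLike.congr_fun (act_mul 𝓐 N s.unop r.unop) y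
  smul_zero r := map_zero (act 𝓐 N r.unop)
  smul_add r := map_add (act 𝓐 N r.unop)
  add_smul r s y := DFunLike.congr_fun (map_add (act 𝓐 N) r.unop s.unop) y
  zero_smul y := DFunLike.congr_fun (map_zero (act 𝓐 N)) y

theorem op_smul_of [GradedRing 𝓐] {j : ℤ} {r : R} (hr : r ∈ 𝓐 j) (n : ℤ) (x : N) :
    MulOpposite.op r • of 𝓐 N n x = of 𝓐 N (n + j) (MulOpposite.op r • x) :=
  act_of 𝓐 N hr n x

/-- The pull-up is a graded module with degree `n` component `N eₙ`. -/
theorem isModuleGrading_component [GradedRing 𝓐] : IsModuleGrading 𝓐 (component 𝓐 N) where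
  isInternal := by
    have hinj (n : ℤ) : Function.Injective (of 𝓐 N n) := DirectSum.of_injective n
    let e (n : ℤ) : N ≃+ component 𝓐 N n := AddMonoidHom.ofInjective (hinj n)
    let E : (⨁ _ : ℤ, N) ≃+ ⨁ n, component 𝓐 N n := DFinsupp.mapRange.addEquiv e
    have key : (DirectSum.coeAddMonoidHom (component 𝓐 N)).comp E.toAddMonoidHom
        = AddMonoidHom.id (PullUp 𝓐 N) := by
      refine hom_ext fun n x => ?_
      have : E (of 𝓐 N n x) = DirectSum.of (fun n => component 𝓐 N n) n (e n x) :=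
        DFinsupp.mapRange_single (hf := fun n => map_zero (e n))
      change DirectSum.coeAddMonoidHom (component 𝓐 N) (E (of 𝓐 N n x)) = of 𝓐 N n x
      rw [this, DirectSum.coeAddMonoidHom_of]
      rfl
    have hfun : ⇑(DirectSum.coeAddMonoidHom (component 𝓐 N)) = E.symm := by
      funext y
      have := DFunLike.congr_fun key (E.symm y)
      simp only [AddMonoidHom.comp_apply, AddEquiv.coe_toAddMonoidHom,
        AddEquiv.apply_symm_apply] at this
      exact this
    change Function.Bijective (DirectSum.coeAddMonoidHom (component 𝓐 N))
    rw [hfun]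
    exact E.symm.bijective
  smul_mem := by
    rintro i j _ r ⟨x, rfl⟩ hr
    exact ⟨MulOpposite.op r • x, (op_smul_of 𝓐 N hr i x).symm⟩

end Basic

end

end PullUp

/-! A grading splits the pull-up: sending the `k`-th copy of an element `m` of degree `i` to `m
e_{i+k}` identifies a ℤ-indexed sum of copies of a graded module `M` with `pM`
(`Coaction.equivPullUp`). Since a right artinian ring is right noetherian, `N` is finitely
presented, so a sum of copies of `N` is pure-projective.

The substance is 2 → 1, by induction on the length of `N`. Pure-projectivity gives a
degree-preserving endomorphism of `pN` with finitely generated range that fixes a nonzero element.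
Fitting's lemma makes a nonzero idempotent of it, and descent on length a primitive one, `e`. The
graded module `X = e(pN)` has finite support (`Coaction.finite_support`), so it is isomorphic to
none of its proper shifts, and the product of two distinct shift conjugates of `e` lies in the
Jacobson radical of the graded endomorphism ring (`shiftConj_mul_mem_jacobson`).

Finite support also makes `x ↦ ∑ e(x eₙ)` a well-defined map `N → X`. By Nakayama, its composite
with the counit `X → N` is injective, hence bijective because `X` is artinian
(`exists_retraction_of_isPrimitiveIdempotent`). So `X` is a graded summand of `N`; the complement is
shorter and its pull-up is a retract of `pN`, so the induction applies to it. -/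

noncomputable section

/-! ### Maps into and out of the pull-up -/

/-- An additive map that commutes with the action of homogeneous elements is linear. -/
def linearMapOfHomogeneous {R : Type u} [Ring R] (𝓐 : ℤ → AddSubgroup R) [GradedRing 𝓐]
    {M : Type v} {W : Type w} [AddCommGroup M] [Module Rᵐᵒᵖ M] [AddCommGroup W] [Module Rᵐᵒᵖ W]
    (f : M →+ W)
    (h : ∀ (j : ℤ) (r : R), r ∈ 𝓐 j → ∀ m, f (MulOpposite.op r • m) = MulOpposite.op r • f m) :
    M →ₗ[Rᵐᵒᵖ] W where
  toFun := f
  map_add' := map_add f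
  map_smul' := by
    intro s m
    obtain ⟨r, rfl⟩ := MulOpposite.op_surjective s
    induction r using DirectSum.Decomposition.inductionOn 𝓐 with
    | zero => simp
    | add a b ha hb => simp_all [add_smul]
    | homogeneous a => exact h _ _ a.2 m

@[simp] theorem linearMapOfHomogeneous_apply {R : Type u} [Ring R] (𝓐 : ℤ → AddSubgroup R)
    [GradedRing 𝓐] {M : Type v} {W : Type w} [AddCommGroup M] [Module Rᵐᵒᵖ M] [AddCommGroup W]
    [Module Rᵐᵒᵖ W] (f : M →+ W) (h) (m : M) : linearMapOfHomogeneous 𝓐 f h m = f m := rfl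

namespace PullUp

variable {R : Type u} [Ring R] {𝓐 : ℤ → AddSubgroup R}
variable {N : Type v} [AddCommGroup N]

/-- The coefficient of `eₙ` in an element of the pull-up. -/
def coeff (n : ℤ) : PullUp 𝓐 N →+ N := DFinsupp.evalAddMonoidHom (β := fun _ : ℤ => N) n

theorem coeff_of_same (n : ℤ) (x : N) : coeff n (of 𝓐 N n x) = x :=
  DirectSum.of_eq_same (β := fun _ : ℤ => N) n x

theorem coeff_of_ne {m n : ℤ} (h : m ≠ n) (x : N) : coeff n (of 𝓐 N m x) = 0 :=
  DirectSum.of_eq_of_ne (β := fun _ : ℤ => N) m n x h.symm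

theorem coeff_of (m n : ℤ) (x : N) : coeff n (of 𝓐 N m x) = if m = n then x else 0 := by
  split_ifs with h
  · subst h; exact coeff_of_same _ _
  · exact coeff_of_ne h _

theorem ext {v w : PullUp 𝓐 N} (h : ∀ n, coeff n v = coeff n w) : v = w :=
  DFinsupp.ext (β := fun _ : ℤ => N) h

theorem of_injective (n : ℤ) : Function.Injective (of 𝓐 N n) := DirectSum.of_injective n

theorem induction {p : PullUp 𝓐 N → Prop} (v : PullUp 𝓐 N) (zero : p 0)
    (of : ∀ n x, p (of 𝓐 N n x)) (add : ∀ v w, p v → p w → p (v + w)) : p v :=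
  DirectSum.induction_on (β := fun _ : ℤ => N) (motive := p) v zero of add

variable (𝓐) in
/-- Additive maps out of the pull-up. -/
def liftAddHom {G : Type*} [AddCommMonoid G] (f : ℤ → N →+ G) : PullUp 𝓐 N →+ G :=
  DirectSum.toAddMonoid (β := fun _ : ℤ => N) f

@[simp] theorem liftAddHom_of {G : Type*} [AddCommMonoid G] (f : ℤ → N →+ G) (n : ℤ) (x : N) :
    liftAddHom 𝓐 f (of 𝓐 N n x) = f n x :=
  DirectSum.toAddMonoid_of _ _ _

theorem exists_support (v : PullUp 𝓐 N) : ∃ T : Finset ℤ, (∀ n ∉ T, coeff n v = 0) ∧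
    v = ∑ n ∈ T, of 𝓐 N n (coeff n v) := by
  classical
  refine ⟨DFinsupp.support (β := fun _ : ℤ => N) v, fun n hn => ?_, ?_⟩
  · exact DFinsupp.notMem_support_iff.mp hn
  · exact (DirectSum.sum_support_of (β := fun _ : ℤ => N) v).symm

variable [Module Rᵐᵒᵖ N]
variable {N' : Type w} [AddCommGroup N'] [Module Rᵐᵒᵖ N']
variable [GradedRing 𝓐]

theorem coeff_smul {j : ℤ} {r : R} (hr : r ∈ 𝓐 j) (n : ℤ) (v : PullUp 𝓐 N) :
    coeff (n + j) (MulOpposite.op r • v) = MulOpposite.op r • coeff n v := by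
  induction v using induction with
  | zero => simp
  | add v w hv hw => simp only [smul_add, map_add, hv, hw]
  | of m x =>
    rw [op_smul_of 𝓐 N hr, coeff_of, coeff_of]
    by_cases h : m = n <;> simp [h]

theorem coeff_smul' {j : ℤ} {r : R} (hr : r ∈ 𝓐 j) (n : ℤ) (v : PullUp 𝓐 N) :
    coeff n (MulOpposite.op r • v) = MulOpposite.op r • coeff (n - j) v := by
  simpa using coeff_smul hr (n - j) v

/-- Linear maps out of the pull-up. -/
def lift (f : ℤ → N →+ N') (hf : ∀ (j : ℤ) (r : R), r ∈ 𝓐 j → ∀ n x,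
    f (n + j) (MulOpposite.op r • x) = MulOpposite.op r • f n x) :
    PullUp 𝓐 N →ₗ[Rᵐᵒᵖ] N' :=
  linearMapOfHomogeneous 𝓐 (liftAddHom 𝓐 f) (by
    intro j r hr v
    induction v using induction with
    | zero => simp
    | add v w hv hw => simp only [smul_add, map_add, hv, hw]
    | of m x => rw [op_smul_of 𝓐 N hr, liftAddHom_of, liftAddHom_of, hf j r hr])

@[simp] theorem lift_of (f : ℤ → N →+ N') (hf) (n : ℤ) (x : N) :
    lift (𝓐 := 𝓐) f hf (of 𝓐 N n x) = f n x := by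
  simp [lift]

theorem linearMap_ext {f g : PullUp 𝓐 N →ₗ[Rᵐᵒᵖ] N'} (h : ∀ n x, f (of 𝓐 N n x) = g (of 𝓐 N n x)) :
    f = g :=
  LinearMap.toAddMonoidHom_injective (hom_ext h)

variable (𝓐 N) in
/-- The canonical map `x eₙ ↦ x` from the pull-up to the module. -/
def counit : PullUp 𝓐 N →ₗ[Rᵐᵒᵖ] N :=
  lift (fun _ => AddMonoidHom.id N) fun _ _ _ _ _ => rfl

@[simp] theorem counit_of (n : ℤ) (x : N) : counit 𝓐 N (of 𝓐 N n x) = x := by simp [counit]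

/-- The shift `x eₙ ↦ x eₙ₊ₖ`. -/
def shift (k : ℤ) : PullUp 𝓐 N →ₗ[Rᵐᵒᵖ] PullUp 𝓐 N :=
  lift (fun n => of 𝓐 N (n + k)) fun j r hr n x => by
    rw [op_smul_of 𝓐 N hr, add_right_comm]

@[simp] theorem shift_of (k n : ℤ) (x : N) :
    shift k (of 𝓐 N n x) = of 𝓐 N (n + k) x := by simp [shift]

theorem shift_shift (k l : ℤ) (v : PullUp 𝓐 N) : shift k (shift l v) = shift (l + k) v := by
  have : (shift k).comp (shift l) = shift (𝓐 := 𝓐) (N := N) (l + k) :=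
    linearMap_ext fun n x => by simp [add_assoc]
  exact LinearMap.congr_fun this v

@[simp] theorem shift_zero : shift (𝓐 := 𝓐) (N := N) 0 = LinearMap.id :=
  linearMap_ext fun n x => by simp

theorem coeff_shift (k n : ℤ) (v : PullUp 𝓐 N) : coeff n (shift k v) = coeff (n - k) v := by
  induction v using induction with
  | zero => simp
  | add v w hv hw => simp only [map_add, hv, hw]
  | of m x => simp [coeff_of, eq_sub_iff_add_eq]

/-- Functoriality of the pull-up. -/
def map (f : N →ₗ[Rᵐᵒᵖ] N') : PullUp 𝓐 N →ₗ[Rᵐᵒᵖ] PullUp 𝓐 N' :=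
  lift (fun n => (of 𝓐 N' n).comp f.toAddMonoidHom) fun j r hr n x => by
    simp [op_smul_of 𝓐 N' hr]

@[simp] theorem map_of (f : N →ₗ[Rᵐᵒᵖ] N') (n : ℤ) (x : N) :
    map f (of 𝓐 N n x) = of 𝓐 N' n (f x) := by simp [map]

@[simp] theorem coeff_map (f : N →ₗ[Rᵐᵒᵖ] N') (n : ℤ) (v : PullUp 𝓐 N) :
    coeff n (map f v) = f (coeff n v) := by
  induction v using induction with
  | zero => simp
  | add v w hv hw => simp only [map_add, hv, hw]
  | of m x => simp only [map_of, coeff_of]; split_ifs <;> simp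

@[simp] theorem counit_map (f : N →ₗ[Rᵐᵒᵖ] N') (v : PullUp 𝓐 N) :
    counit 𝓐 N' (map f v) = f (counit 𝓐 N v) := by
  induction v using induction with
  | zero => simp
  | add v w hv hw => simp only [map_add, hv, hw]
  | of m x => simp

/-- The degree-preserving part of an endomorphism of the pull-up. -/
def degreeZeroPart (φ : Module.End Rᵐᵒᵖ (PullUp 𝓐 N)) : Module.End Rᵐᵒᵖ (PullUp 𝓐 N) :=
  lift (fun n => (of 𝓐 N n).comp ((coeff n).comp (φ.toAddMonoidHom.comp (of 𝓐 N n))))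
    fun j r hr n x => by
      simp only [AddMonoidHom.comp_apply, LinearMap.toAddMonoidHom_coe]
      rw [← op_smul_of 𝓐 N hr, map_smul, coeff_smul hr, op_smul_of 𝓐 N hr]

@[simp] theorem degreeZeroPart_of (φ : Module.End Rᵐᵒᵖ (PullUp 𝓐 N)) (n : ℤ) (x : N) :
    degreeZeroPart φ (of 𝓐 N n x) = of 𝓐 N n (coeff n (φ (of 𝓐 N n x))) := by
  simp [degreeZeroPart]

end PullUp

/-! ### Gradings as coactions -/

open PullUp

variable {R : Type u} [Ring R] (𝓐 : ℤ → AddSubgroup R) [GradedRing 𝓐]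

/-- A `ℤ`-grading of a right module `M`, given by the linear map `m ↦ ∑ mₙ eₙ` to the pull-up. -/
structure Coaction (M : Type v) [AddCommGroup M] [Module Rᵐᵒᵖ M] where
  /-- `m ↦ ∑ mₙ eₙ`. -/
  hom : M →ₗ[Rᵐᵒᵖ] PullUp 𝓐 M
  counit_hom : ∀ m, counit 𝓐 M (hom m) = m
  hom_coeff_hom : ∀ n m, hom (coeff n (hom m)) = of 𝓐 M n (coeff n (hom m))

namespace Coaction

variable {𝓐} {M : Type v} [AddCommGroup M] [Module Rᵐᵒᵖ M] (c : Coaction 𝓐 M)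

/-- The projection to the component of degree `n`. -/
def proj (n : ℤ) : M →+ M := (coeff n).comp c.hom.toAddMonoidHom

theorem coeff_hom (n : ℤ) (m : M) : coeff n (c.hom m) = c.proj n m := rfl

theorem hom_proj (n : ℤ) (m : M) : c.hom (c.proj n m) = of 𝓐 M n (c.proj n m) :=
  c.hom_coeff_hom n m

theorem proj_proj_same (n : ℤ) (m : M) : c.proj n (c.proj n m) = c.proj n m := by
  rw [← c.coeff_hom n (c.proj n m), hom_proj, coeff_of_same]

theorem proj_proj_ne {k n : ℤ} (h : n ≠ k) (m : M) : c.proj k (c.proj n m) = 0 := by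
  rw [← c.coeff_hom k (c.proj n m), hom_proj, coeff_of_ne h]

theorem proj_smul {j : ℤ} {r : R} (hr : r ∈ 𝓐 j) (n : ℤ) (m : M) :
    c.proj (n + j) (MulOpposite.op r • m) = MulOpposite.op r • c.proj n m := by
  rw [← coeff_hom, map_smul, coeff_smul hr, coeff_hom]

theorem exists_support (m : M) : ∃ T : Finset ℤ, (∀ n ∉ T, c.proj n m = 0) ∧
    m = ∑ n ∈ T, c.proj n m := by
  obtain ⟨T, h0, h1⟩ := PullUp.exists_support (c.hom m)
  refine ⟨T, h0, ?_⟩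
  have := congrArg (counit 𝓐 M) h1
  simpa [c.counit_hom, coeff_hom] using this

theorem ext {m m' : M} (h : ∀ n, c.proj n m = c.proj n m') : m = m' := by
  rw [← c.counit_hom m, PullUp.ext (v := c.hom m) (w := c.hom m') h, c.counit_hom]

theorem hom_eq_of {n : ℤ} {m : M} (h : c.proj n m = m) : c.hom m = of 𝓐 M n m := by
  rw [← h, hom_proj]

/-- The component of degree `n`. -/
def component (n : ℤ) : AddSubgroup M := (c.proj n).range

theorem proj_of_mem_component {n : ℤ} {m : M} (h : m ∈ c.component n) : c.proj n m = m := by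
  obtain ⟨m, rfl⟩ := h
  exact c.proj_proj_same n m

theorem isModuleGrading : IsModuleGrading 𝓐 c.component where
  isInternal := by
    classical
    let q (n : ℤ) : M →+ c.component n := (c.proj n).rangeRestrict
    have hq (n : ℤ) (x : M) : (q n x : M) = c.proj n x := rfl
    let d : PullUp 𝓐 M →+ ⨁ n, c.component n := liftAddHom 𝓐 fun n =>
      (DirectSum.of (fun n => c.component n) n).comp (q n)
    let D : DirectSum.Decomposition c.component :=
      DirectSum.Decomposition.ofAddHom _ (d.comp c.hom.toAddMonoidHom)
      (by
        ext m
        obtain ⟨T, -, hT⟩ := c.exists_support m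
        change DirectSum.coeAddMonoidHom c.component (d (c.hom m)) = m
        rw [hT]
        simp only [map_sum]
        refine Finset.sum_congr rfl fun n _ => ?_
        simp [hom_proj, d, hq, c.proj_proj_same])
      (by
        ext n ⟨x, hx⟩ : 2
        have hx' := c.proj_of_mem_component hx
        have hqx : q n x = ⟨x, hx⟩ := Subtype.ext hx'
        change d (c.hom (DirectSum.coeAddMonoidHom c.component
          (DirectSum.of (fun n => c.component n) n ⟨x, hx⟩))) = _
        rw [DirectSum.coeAddMonoidHom_of, c.hom_eq_of hx']
        simp [d, hqx])
    exact DirectSum.Decomposition.isInternal _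
  smul_mem := by
    rintro i j _ r ⟨m, rfl⟩ hr
    exact ⟨_, c.proj_smul hr i m⟩

theorem isGradable (c : Coaction 𝓐 M) : IsGradable 𝓐 M :=
  ⟨M, _, _, c.component, c.isModuleGrading, ⟨LinearEquiv.refl _ _⟩⟩

/-- The coaction of a graded module. -/
def ofGrading {ℳ : ℤ → AddSubgroup M} (h : IsModuleGrading 𝓐 ℳ) : Coaction 𝓐 M := by
  classical
  letI : DirectSum.Decomposition ℳ := h.isInternal.chooseDecomposition
  let g : M →+ PullUp 𝓐 M :=
    (DirectSum.toAddMonoid fun n => (of 𝓐 M n).comp (ℳ n).subtype).comp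
      (DirectSum.decomposeAddEquiv ℳ).toAddMonoidHom
  have hg (n : ℤ) (m : M) (hm : m ∈ ℳ n) : g m = of 𝓐 M n m := by
    simp [g, DirectSum.decompose_of_mem ℳ hm]
  have hmem (m : M) (n : ℤ) : coeff n (g m) ∈ ℳ n := by
    induction m using DirectSum.Decomposition.inductionOn ℳ with
    | zero => simp
    | add a b ha hb => simpa using add_mem ha hb
    | @homogeneous k a =>
      rw [hg k a a.2, coeff_of]
      split_ifs with h
      · subst h; exact a.2
      · exact zero_mem _
  exact
    { hom := linearMapOfHomogeneous 𝓐 g fun j r hr m => by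
        induction m using DirectSum.Decomposition.inductionOn ℳ with
        | zero => simp
        | add a b ha hb => simp only [smul_add, map_add, ha, hb]
        | @homogeneous i a =>
          rw [hg i a a.2, hg (i + j) _ (h.smul_mem i j a r a.2 hr), op_smul_of 𝓐 M hr]
      counit_hom := fun m => by
        induction m using DirectSum.Decomposition.inductionOn ℳ with
        | zero => simp
        | add a b ha hb => simp only [map_add, ha, hb]
        | @homogeneous i a => simp [hg i a a.2]
      hom_coeff_hom := fun n m => hg n _ (hmem m n) }

/-- The pull-up of a graded module is a direct sum of copies of the module. -/
def equivPullUp : (ℤ →₀ M) ≃ₗ[Rᵐᵒᵖ] PullUp 𝓐 M := by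
  -- On `m` homogeneous of degree `i`, `f` sends the `k`-th copy of `m` to `m e_{i+k}`, and `g`
  -- sends `m eₙ` to the copy of index `n - i`.
  let f : (ℤ →₀ M) →ₗ[Rᵐᵒᵖ] PullUp 𝓐 M := Finsupp.lsum ℕ fun k => (shift k).comp c.hom
  let g' (k : ℤ) : PullUp 𝓐 M →+ (ℤ →₀ M) := liftAddHom 𝓐 fun i =>
    Finsupp.singleAddHom (k - i)
  let g : PullUp 𝓐 M →+ (ℤ →₀ M) := liftAddHom 𝓐 fun n => (g' n).comp c.hom.toAddMonoidHom
  have hf (k : ℤ) (x : M) : f (Finsupp.single k x) = shift k (c.hom x) := by simp [f]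
  have hg' (k i : ℤ) (x : M) : g' k (of 𝓐 M i x) = Finsupp.single (k - i) x := by
    simp [g']
  have hg (n : ℤ) (x : M) : g (of 𝓐 M n x) = g' n (c.hom x) := by simp [g]
  refine { f with invFun := g, left_inv := ?_, right_inv := ?_ }
  · intro y
    change g (f y) = y
    induction y using Finsupp.induction_linear with
    | zero => simp
    | add a b ha hb => simp only [map_add, ha, hb]
    | single k x =>
      obtain ⟨T, -, hT⟩ := c.exists_support x
      rw [hT]
      simp only [Finsupp.single_finsetSum, map_sum]
      refine Finset.sum_congr rfl fun n _ => ?_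
      rw [hf, hom_proj, shift_of, hg, hom_proj, hg', add_sub_cancel_left]
  · intro v
    change f (g v) = v
    induction v using PullUp.induction with
    | zero => simp
    | add v w hv hw => simp only [map_add, hv, hw]
    | of n x =>
      obtain ⟨T, -, hT⟩ := c.exists_support x
      rw [hT]
      simp only [map_sum]
      refine Finset.sum_congr rfl fun i _ => ?_
      rw [hg, hom_proj, hg', hf, hom_proj, shift_of, add_sub_cancel]

end Coaction

end

/-! ### Finite support of finitely generated graded modules -/

noncomputable section
open PullUp

/-- This is the source of all contradictions with finite support below: a nonzero component that
propagates by a fixed step `d` forces `d = 0`. -/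
theorem Int.eq_zero_of_forall_add_mul_mem {s : Set ℤ} (hs : s.Finite) {k d : ℤ}
    (h : ∀ j : ℕ, k + j * d ∈ s) : d = 0 := by
  by_contra hd
  refine Set.infinite_of_injective_forall_mem (f := fun j : ℕ => k + j * d) ?_ h hs
  intro i j hij
  simpa [hd] using hij

namespace Coaction

variable {R : Type u} [Ring R] {𝓐 : ℤ → AddSubgroup R} [GradedRing 𝓐]
variable {M : Type v} [AddCommGroup M] [Module Rᵐᵒᵖ M]

/-- A coaction from a family of projections. -/
def ofProj (p : ℤ → M →+ M)
    (hp : ∀ m, ∃ T : Finset ℤ, (∀ n ∉ T, p n m = 0) ∧ m = ∑ n ∈ T, p n m)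
    (hsame : ∀ n m, p n (p n m) = p n m) (hne : ∀ n k, n ≠ k → ∀ m, p k (p n m) = 0)
    (hsmul : ∀ (j : ℤ) (r : R), r ∈ 𝓐 j → ∀ n m,
      p (n + j) (MulOpposite.op r • m) = MulOpposite.op r • p n m) : Coaction 𝓐 M :=
  -- The chosen finite set is immaterial: each coefficient is the given projection, so identities
  -- can be checked coefficientwise.
  have hc (m : M) (k : ℤ) :
      coeff k (∑ n ∈ (hp m).choose, of 𝓐 M n (p n m)) = p k m := by
    simp only [map_sum, coeff_of, Finset.sum_ite_eq']
    split_ifs with h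
    · rfl
    · exact ((hp m).choose_spec.1 k h).symm
  { hom := linearMapOfHomogeneous 𝓐
      (AddMonoidHom.mk' (fun m => ∑ n ∈ (hp m).choose, of 𝓐 M n (p n m))
        fun a b => PullUp.ext fun k => by rw [map_add, hc, hc, hc, map_add])
      (fun j r hr m => PullUp.ext fun k => by
        rw [AddMonoidHom.mk'_apply, hc, coeff_smul' hr, hc, ← hsmul j r hr,
          sub_add_cancel])
    counit_hom := fun m => by
      simpa using (hp m).choose_spec.2.symm
    hom_coeff_hom := fun n m => PullUp.ext fun k => by
      simp only [linearMapOfHomogeneous_apply, AddMonoidHom.mk'_apply, hc]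
      rw [coeff_of]
      split_ifs with h
      · subst h; exact hsame _ _
      · exact hne n k h _ }

theorem ofProj_proj (p : ℤ → M →+ M) (hp hsame hne hsmul) (k : ℤ) (m : M) :
    (ofProj (𝓐 := 𝓐) p hp hsame hne hsmul).proj k m = p k m := by
  change coeff k (∑ n ∈ (hp m).choose, of 𝓐 M n (p n m)) = p k m
  simp only [map_sum, coeff_of, Finset.sum_ite_eq']
  split_ifs with h
  · rfl
  · exact ((hp m).choose_spec.1 k h).symm

variable (c : Coaction 𝓐 M)

/-- The induced grading of a homogeneous submodule. -/
def restrict (Y : Submodule Rᵐᵒᵖ M) (hY : ∀ n, ∀ y ∈ Y, c.proj n y ∈ Y) : Coaction 𝓐 Y :=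
  ofProj (fun n => AddMonoidHom.mk' (fun y => ⟨c.proj n y, hY n y y.2⟩)
      fun a b => Subtype.ext (map_add (c.proj n) (a : M) b))
    (fun m => by
      obtain ⟨T, h0, h1⟩ := c.exists_support (m : M)
      refine ⟨T, fun n hn => Subtype.ext (h0 n hn), Subtype.ext ?_⟩
      rw [AddSubmonoidClass.coe_finsetSum]
      exact h1)
    (fun n m => Subtype.ext (c.proj_proj_same n m))
    (fun n k h m => Subtype.ext (c.proj_proj_ne h m))
    (fun j r hr n m => Subtype.ext (c.proj_smul hr n m))

theorem coe_restrict_proj (Y : Submodule Rᵐᵒᵖ M) (hY : ∀ n, ∀ y ∈ Y, c.proj n y ∈ Y) (n : ℤ)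
    (y : Y) : ((c.restrict Y hY).proj n y : M) = c.proj n y := by
  rw [restrict, ofProj_proj]; rfl

section Quotient

variable {Q : Type w} [AddCommGroup Q] [Module Rᵐᵒᵖ Q] (π : M →ₗ[Rᵐᵒᵖ] Q)

theorem map_proj_surjInv (hπ : Function.Surjective π)
    (hker : ∀ n m, π m = 0 → π (c.proj n m) = 0) (n : ℤ) (m : M) :
    π (c.proj n (Function.surjInv hπ (π m))) = π (c.proj n m) := by
  rw [← sub_eq_zero, ← map_sub, ← map_sub]
  exact hker _ _ (by rw [map_sub, Function.surjInv_eq hπ, sub_self])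

/-- The induced grading of a quotient by a homogeneous submodule. -/
def quotient (hπ : Function.Surjective π)
    (hker : ∀ n m, π m = 0 → π (c.proj n m) = 0) : Coaction 𝓐 Q :=
  have key := c.map_proj_surjInv π hπ hker
  ofProj (fun n => AddMonoidHom.mk' (fun q => π (c.proj n (Function.surjInv hπ q))) fun a b => by
      obtain ⟨a, rfl⟩ := hπ a
      obtain ⟨b, rfl⟩ := hπ b
      rw [← map_add, key, key, key, map_add, map_add])
    (fun q => by
      obtain ⟨m, rfl⟩ := hπ q
      obtain ⟨T, h0, h1⟩ := c.exists_support m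
      refine ⟨T, fun n hn => ?_, ?_⟩
      · rw [AddMonoidHom.mk'_apply, key, h0 n hn, map_zero]
      · simp only [AddMonoidHom.mk'_apply, key]
        rw [← map_sum, ← h1])
    (fun n q => by
      obtain ⟨m, rfl⟩ := hπ q
      simp only [AddMonoidHom.mk'_apply, key, c.proj_proj_same])
    (fun n k h q => by
      obtain ⟨m, rfl⟩ := hπ q
      simp only [AddMonoidHom.mk'_apply, key, c.proj_proj_ne h, map_zero])
    (fun j r hr n q => by
      obtain ⟨m, rfl⟩ := hπ q
      simp only [AddMonoidHom.mk'_apply, ← map_smul, key, c.proj_smul hr])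

theorem quotient_proj (hπ : Function.Surjective π)
    (hker : ∀ n m, π m = 0 → π (c.proj n m) = 0) (n : ℤ) (m : M) :
    (c.quotient π hπ hker).proj n (π m) = π (c.proj n m) := by
  rw [quotient, ofProj_proj]
  exact c.map_proj_surjInv π hπ hker n m

end Quotient

theorem proj_smul_of_homogeneous {n : ℤ} {x : M} (hx : c.proj n x = x) (r : R) (k : ℤ) :
    c.proj k (MulOpposite.op r • x) =
      MulOpposite.op (DirectSum.decompose 𝓐 r (k - n) : R) • x := by
  induction r using DirectSum.Decomposition.inductionOn 𝓐 with
  | zero => simp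
  | add a b ha hb => simp [add_smul, ha, hb]
  | @homogeneous i a =>
    by_cases h : i = k - n
    · subst h
      have := c.proj_smul a.2 n x
      rw [add_sub_cancel, hx] at this
      rw [this, DirectSum.decompose_coe, DirectSum.of_eq_same]
    · rw [DirectSum.decompose_of_mem_ne 𝓐 a.2 h, MulOpposite.op_zero, zero_smul]
      have := c.proj_smul a.2 n x
      rw [hx] at this
      rw [← this, c.proj_proj_ne (by lia)]

theorem finite_setOf_proj_ne_zero (m : M) : {n | c.proj n m ≠ 0}.Finite := by
  obtain ⟨T, h0, -⟩ := c.exists_support m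
  exact T.finite_toSet.subset fun n hn => by_contra fun h => hn (h0 n h)

/-- The module has no homogeneous submodules besides `⊥` and `⊤`. -/
def IsGradedSimple : Prop :=
  ∀ Y : Submodule Rᵐᵒᵖ M, (∀ n, ∀ y ∈ Y, c.proj n y ∈ Y) → Y = ⊥ ∨ Y = ⊤

variable {c}

/-- If `a ≠ 0`, its homogeneous kernel is zero. Elements have only finitely many components, so `1 -
a` is injective, and then surjective by the artinian hypothesis. But solving `(1 - a) y = z` with `z
≠ 0` homogeneous would need an infinite geometric series in one direction or the other. -/
theorem IsGradedSimple.eq_zero_of_degree_ne_zero [IsArtinian Rᵐᵒᵖ M]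
    (hc : c.IsGradedSimple) {d : ℤ} (hd : d ≠ 0) (a : M →ₗ[Rᵐᵒᵖ] M)
    (ha : ∀ n m, c.proj (n + d) (a m) = a (c.proj n m)) : a = 0 := by
  rcases hc (LinearMap.ker a) (fun n y hy => by
    rw [LinearMap.mem_ker] at hy ⊢
    rw [← ha, hy, map_zero]) with h | h
  swap
  · exact LinearMap.ker_eq_top.mp h
  by_contra ha0
  have hinj : Function.Injective a := LinearMap.ker_eq_bot.mp h
  have hne (y : M) (hy : y ≠ 0) : a y ≠ 0 := fun h0 => hy (hinj (by rw [h0, map_zero]))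
  have h1inj : Function.Injective (LinearMap.id - a : M →ₗ[Rᵐᵒᵖ] M) := by
    rw [← LinearMap.ker_eq_bot, LinearMap.ker_eq_bot']
    intro y hy
    rw [LinearMap.sub_apply, LinearMap.id_apply, sub_eq_zero] at hy
    by_contra hy0
    obtain ⟨k, hk⟩ : ∃ k, c.proj k y ≠ 0 := by
      by_contra! hk
      exact hy0 (c.ext fun n => by rw [hk, map_zero])
    refine hd (Int.eq_zero_of_forall_add_mul_mem (c.finite_setOf_proj_ne_zero y) (k := k)
      fun j => ?_)
    induction j with
    | zero => simpa using hk
    | succ j ih =>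
      change c.proj _ y ≠ 0
      rw [show k + ((j + 1 : ℕ) : ℤ) * d = k + j * d + d by push_cast; ring, hy, ha]
      exact hne _ ih
  have hsurj := IsArtinian.surjective_of_injective_endomorphism _ h1inj
  obtain ⟨x, hx⟩ : ∃ x, a x ≠ 0 := by
    by_contra! hx
    exact ha0 (LinearMap.ext hx)
  obtain ⟨k, hk⟩ : ∃ k, c.proj k x ≠ 0 := by
    by_contra! hk
    exact hx (by rw [c.ext (m := x) (m' := 0) fun n => by rw [hk, map_zero], map_zero])
  obtain ⟨y, hy⟩ := hsurj (c.proj k x)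
  rw [LinearMap.sub_apply, LinearMap.id_apply] at hy
  have hfin := c.finite_setOf_proj_ne_zero y
  -- Away from degree `k`, `y` and `a y` have the same components; in degree `k` they differ by the
  -- nonzero right-hand side. Hence either `y_k ≠ 0`, which propagates upwards, or `a(y_{k-d}) ≠ 0`,
  -- which propagates downwards.
  have hstep (n : ℤ) (hn : n + d ≠ k) : c.proj (n + d) y = a (c.proj n y) := by
    rw [← sub_eq_zero, ← ha, ← map_sub, hy, c.proj_proj_ne hn.symm]
  have hat : c.proj k y - a (c.proj (k - d) y) ≠ 0 := by
    rw [← ha, sub_add_cancel, ← map_sub, hy, c.proj_proj_same]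
    exact hk
  by_cases hky : c.proj k y = 0
  · rw [hky, zero_sub, neg_ne_zero] at hat
    refine hd (neg_eq_zero.mp (Int.eq_zero_of_forall_add_mul_mem hfin (k := k - d) (d := -d)
      fun j => ?_))
    induction j with
    | zero =>
      change c.proj _ y ≠ 0
      intro h0
      simp only [Nat.cast_zero, zero_mul, add_zero] at h0
      exact hat (by rw [h0, map_zero])
    | succ j ih =>
      change c.proj _ y ≠ 0
      intro h0
      refine ih ?_
      have := hstep (k - d + ((j + 1 : ℕ) : ℤ) * -d) (by
        intro h
        have h' : ((j + 1 : ℕ) : ℤ) * d = 0 := by linear_combination -h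
        rcases mul_eq_zero.mp h' with h' | h'
        · exact absurd h' (by positivity)
        · exact hd h')
      rw [h0, map_zero] at this
      rw [← this]
      congr 2
      push_cast; ring
  · refine hd (Int.eq_zero_of_forall_add_mul_mem hfin (k := k) fun j => ?_)
    induction j with
    | zero => simpa using hky
    | succ j ih =>
      change c.proj _ y ≠ 0
      rw [show k + ((j + 1 : ℕ) : ℤ) * d = k + j * d + d by push_cast; ring, hstep]
      · exact hne _ ih
      · intro h
        have h' : ((j + 1 : ℕ) : ℤ) * d = 0 := by push_cast; linear_combination h
        rcases mul_eq_zero.mp h' with h' | h'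
        · exact absurd h' (by positivity)
        · exact hd h'

variable (R) in
/-- The left ideal of elements of `Rᵐᵒᵖ` that annihilate `x n` for all `n ∈ F`. -/
def annihilating (x : ℤ → M) (F : Finset ℤ) : Submodule Rᵐᵒᵖ Rᵐᵒᵖ where
  carrier := {s | ∀ n ∈ F, s • x n = 0}
  add_mem' ha hb n hn := by rw [add_smul, ha n hn, hb n hn, add_zero]
  zero_mem' n _ := zero_smul _ _
  smul_mem' r s hs n hn := by rw [smul_assoc, hs n hn, smul_zero]

theorem decompose_mem_annihilating {x : ℤ → M} (F : Finset ℤ) (hx : ∀ n ∈ F, c.proj n (x n) = x n)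
    {r : R} (hr : MulOpposite.op r ∈ annihilating R x F) (j : ℤ) :
    MulOpposite.op (DirectSum.decompose 𝓐 r j : R) ∈ annihilating R x F := by
  intro n hn
  have := c.proj_smul_of_homogeneous (hx n hn) r (n + j)
  rw [hr n hn, map_zero, add_sub_cancel_left] at this
  exact this.symm

/-- A graded form of the density argument. If whatever kills `x n` (within the annihilator of the
earlier elements) also killed `x m`, then `s • x n ↦ s • x m` would be a nonzero endomorphism of
degree `m - n ≠ 0`. -/
theorem IsGradedSimple.exists_mem_annihilating [IsArtinian Rᵐᵒᵖ M] (hc : c.IsGradedSimple)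
    (x : ℤ → M) {D : Set ℤ} (hx : ∀ n ∈ D, c.proj n (x n) = x n) (hx0 : ∀ n ∈ D, x n ≠ 0)
    (F : Finset ℤ) : (F : Set ℤ) ⊆ D → ∀ m ∈ D, m ∉ F →
      ∃ s ∈ annihilating R x F, s • x m ≠ 0 := by
  classical
  induction F using Finset.induction_on with
  | empty =>
    intro _ m hm _
    exact ⟨1, fun n hn => absurd hn (Finset.notMem_empty n), by rw [one_smul]; exact hx0 m hm⟩
  | insert n F hnF ih =>
    intro hFD m hm hmF
    have hF : (F : Set ℤ) ⊆ D := fun i hi => hFD (by simp [Finset.mem_coe.mp hi])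
    have hn : n ∈ D := hFD (by simp)
    rw [Finset.mem_insert, not_or] at hmF
    by_contra! hcon
    let f (k : ℤ) : annihilating R x F →ₗ[Rᵐᵒᵖ] M :=
      (LinearMap.toSpanSingleton Rᵐᵒᵖ M (x k)).comp (annihilating R x F).subtype
    have hf (k : ℤ) (s : annihilating R x F) : f k s = (s : Rᵐᵒᵖ) • x k := rfl
    have hcomp {k : ℤ} (hk : k ∈ D) (i : ℤ) (s : annihilating R x F) :
        c.proj i (f k s) = f k ⟨MulOpposite.op (DirectSum.decompose 𝓐 (s : Rᵐᵒᵖ).unop (i - k) : R),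
          decompose_mem_annihilating F (fun n hn => hx n (hF hn)) s.2 _⟩ :=
      c.proj_smul_of_homogeneous (hx k hk) (s : Rᵐᵒᵖ).unop i
    -- The image is a homogeneous submodule, nonzero by the induction hypothesis for `n`.
    have hfn : Function.Surjective (f n) := by
      rw [← LinearMap.range_eq_top]
      refine (hc (LinearMap.range (f n)) ?_).resolve_left ?_
      · rintro i _ ⟨s, rfl⟩
        exact ⟨_, (hcomp hn i s).symm⟩
      · intro h
        obtain ⟨s, hs, hs0⟩ := ih hF n hn hnF
        exact hs0 (LinearMap.congr_fun (LinearMap.range_eq_bot.mp h) ⟨s, hs⟩)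
    have hker : LinearMap.ker (f n) ≤ LinearMap.ker (f m) := by
      intro s hs
      refine hcon s fun i hi => ?_
      rcases Finset.mem_insert.mp hi with rfl | hi
      · exact hs
      · exact s.2 i hi
    let a : M →ₗ[Rᵐᵒᵖ] M := ((LinearMap.ker (f n)).liftQ (f m) hker).comp
      ((f n).quotKerEquivOfSurjective hfn).symm.toLinearMap
    have haf (s : annihilating R x F) : a (f n s) = f m s := by
      have : ((f n).quotKerEquivOfSurjective hfn).symm (f n s) = (LinearMap.ker (f n)).mkQ s := by
        rw [LinearEquiv.symm_apply_eq]; rfl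
      simp only [a, LinearMap.comp_apply, LinearEquiv.coe_coe, this]
      rfl
    have ha0 : a = 0 := hc.eq_zero_of_degree_ne_zero (d := m - n) (sub_ne_zero.mpr hmF.1) a
      fun i y => by
        obtain ⟨s, rfl⟩ := hfn y
        have hidx : ∀ k l, k = l → ((DirectSum.decompose 𝓐 (s : Rᵐᵒᵖ).unop k : R)) =
          DirectSum.decompose 𝓐 (s : Rᵐᵒᵖ).unop l := by rintro _ _ rfl; rfl
        rw [haf, hcomp hn, haf, hcomp hm, hf, hf]
        change MulOpposite.op (_ : R) • x m = MulOpposite.op (_ : R) • x m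
        rw [hidx (i + (m - n) - m) (i - n) (by ring)]
    obtain ⟨s, hs, hs0⟩ := ih hF m hm hmF.2
    exact hs0 (by rw [← hf m ⟨s, hs⟩, ← haf, ha0, LinearMap.zero_apply])

/-- Infinite support would supply infinitely many nonzero homogeneous elements of distinct degrees,
whose successive annihilators form a strictly descending chain of one-sided ideals. -/
theorem IsGradedSimple.finite_support [IsArtinianRing Rᵐᵒᵖ] [IsArtinian Rᵐᵒᵖ M]
    (hc : c.IsGradedSimple) : {n | ∃ m, c.proj n m ≠ 0}.Finite := by
  classical
  by_contra hinf
  have hD : Set.Infinite {n | ∃ m, c.proj n m ≠ 0} := hinf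
  have hex : ∀ n, ∃ y, n ∈ {n | ∃ m, c.proj n m ≠ 0} → c.proj n y = y ∧ y ≠ 0 := by
    intro n
    by_cases h : ∃ m, c.proj n m ≠ 0
    · obtain ⟨m, hm⟩ := h
      exact ⟨c.proj n m, fun _ => ⟨c.proj_proj_same n m, hm⟩⟩
    · exact ⟨0, fun h' => absurd h' h⟩
  choose x hx using hex
  let g : ℕ ↪ {n | ∃ m, c.proj n m ≠ 0} := hD.natEmbedding
  let F (k : ℕ) : Finset ℤ := (Finset.range k).image fun i => (g i : ℤ)
  have hmono : ∀ {k l : ℕ}, k ≤ l → annihilating R x (F l) ≤ annihilating R x (F k) :=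
    fun hkl s hs n hn => hs n (Finset.image_subset_image (Finset.range_mono hkl) hn)
  obtain ⟨k, hk⟩ := IsArtinian.monotone_stabilizes (R := Rᵐᵒᵖ) (M := Rᵐᵒᵖ)
    ⟨fun k => OrderDual.toDual (annihilating R x (F k)), fun k l hkl => hmono hkl⟩
  have hk1 : annihilating R x (F k) = annihilating R x (F (k + 1)) := hk (k + 1) (Nat.le_succ k)
  obtain ⟨s, hs, hs0⟩ := hc.exists_mem_annihilating x (fun n hn => (hx n hn).1)
    (fun n hn => (hx n hn).2) (F k) (by
      intro n hn
      obtain ⟨i, -, rfl⟩ := Finset.mem_image.mp hn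
      exact (g i).2) (g k) (g k).2 (by
      intro hmem
      obtain ⟨i, hi, hik⟩ := Finset.mem_image.mp hmem
      have := g.injective (Subtype.ext hik)
      simp [this] at hi)
  rw [hk1] at hs
  exact hs0 (hs _ (Finset.mem_image.mpr ⟨k, by simp, rfl⟩))

/-- A graded module of finite length over a graded right artinian ring has finite support. -/
theorem finite_support [IsArtinianRing Rᵐᵒᵖ] (c : Coaction 𝓐 M) [Module.Finite Rᵐᵒᵖ M] :
    {n | ∃ m, c.proj n m ≠ 0}.Finite := by
  induction h : Module.length Rᵐᵒᵖ M using WellFoundedLT.induction generalizing M with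
  | ind l ih =>
    subst h
    by_cases hc : c.IsGradedSimple
    · exact hc.finite_support
    rw [IsGradedSimple] at hc
    push Not at hc
    obtain ⟨Y, hY, hbot, htop⟩ := hc
    have h1 := ih _ (Submodule.length_lt htop) (c.restrict Y hY) rfl
    have hker : ∀ n m, Y.mkQ m = 0 → Y.mkQ (c.proj n m) = 0 := fun n m => by
      simpa using hY n m
    have h2 := ih _ (Submodule.length_quotient_lt Y hbot)
      (c.quotient Y.mkQ Y.mkQ_surjective hker) rfl
    refine (h1.union h2).subset ?_
    rintro n ⟨m, hm⟩
    -- A nonzero component of degree `n` either lies in `Y` or survives in the quotient, so the two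
    -- supports cover that of `M`.
    by_cases hmY : c.proj n m ∈ Y
    · refine Or.inl ⟨⟨_, hmY⟩, fun h0 => hm ?_⟩
      have := congrArg Subtype.val h0
      rwa [coe_restrict_proj, c.proj_proj_same] at this
    · refine Or.inr ⟨Y.mkQ m, fun h0 => hmY ?_⟩
      rw [quotient_proj] at h0
      simpa using h0

end Coaction
end

/-! ### Primitive idempotents, Fitting's lemma and Nakayama's lemma -/

noncomputable section

/-- A primitive idempotent of a ring. -/
structure IsPrimitiveIdempotent {Λ : Type*} [Ring Λ] (e : Λ) : Prop where
  mul_self : e * e = e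
  ne_zero : e ≠ 0
  eq_zero_or_eq : ∀ g : Λ, g * g = g → e * g = g → g * e = g → g = 0 ∨ g = e

/-- Some power of `a` has a quasi-inverse commuting with it. -/
def HasFittingPower {Λ : Type*} [Ring Λ] (a : Λ) : Prop :=
  ∃ (n : ℕ) (c : Λ), c * a ^ (n + 1) = a ^ (n + 1) * c ∧
    a ^ (n + 1) * c * a ^ (n + 1) = a ^ (n + 1)

section RingTheory

variable {Λ : Type*} [Ring Λ] {e e' : Λ}

/-- The Fitting idempotent of `x = e a e' b e` lies under `e`, so it is `0` or `e`. In the first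
case `x` is nilpotent; in the second `p = e a e'` has a right inverse `q` relative to `e`, and `q p`
is a nonzero idempotent under `e'`, hence `e'`. -/
theorem IsPrimitiveIdempotent.isNilpotent_or_exists_iso (he : IsPrimitiveIdempotent e)
    (he' : IsPrimitiveIdempotent e') (a b : Λ)
    (hfit : HasFittingPower (e * a * e' * b * e)) :
    IsNilpotent (e * a * e' * b * e) ∨
      ∃ p q, p * q = e ∧ q * p = e' ∧ e * p = p ∧ p * e' = p ∧ e' * q = q ∧ q * e = q := by
  have hee := he.mul_self
  have hee' := he'.mul_self
  set x := e * a * e' * b * e with hx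
  obtain ⟨n, c, hcomm, hreg⟩ := hfit
  have hex : e * x = x := by simp only [hx, ← mul_assoc, hee]
  have hxe : x * e = x := by simp only [hx, mul_assoc, hee]
  have hg : x ^ (n + 1) * c * (x ^ (n + 1) * c) = x ^ (n + 1) * c := by
    rw [← mul_assoc, hreg]
  rcases he.eq_zero_or_eq _ hg (by rw [pow_succ', ← mul_assoc, ← mul_assoc, hex])
    (by rw [← hcomm, pow_succ, mul_assoc, mul_assoc, hxe]) with h | h
  · left
    exact ⟨n + 1, by rw [← hreg, h, zero_mul]⟩
  right
  have hp : e * (e * a * e') = e * a * e' := by simp only [← mul_assoc, hee]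
  have hp' : e * a * e' * e' = e * a * e' := by rw [mul_assoc, hee']
  have hq : e' * (e' * b * e * x ^ n * c * e) = e' * b * e * x ^ n * c * e := by
    simp only [← mul_assoc, hee']
  have hq' : e' * b * e * x ^ n * c * e * e = e' * b * e * x ^ n * c * e := by rw [mul_assoc, hee]
  have hpq : e * a * e' * (e' * b * e * x ^ n * c * e) = e := by
    calc e * a * e' * (e' * b * e * x ^ n * c * e)
        = e * a * (e' * e') * b * e * x ^ n * c * e := by simp only [mul_assoc]
      _ = x ^ (n + 1) * c * e := by rw [hee', ← hx, pow_succ']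
      _ = e := by rw [h, hee]
  refine ⟨_, _, hpq, ?_, hp, hp', hq, hq'⟩
  generalize e * a * e' = p at *
  generalize e' * b * e * x ^ n * c * e = q at *
  refine (he'.eq_zero_or_eq (q * p) ?_ ?_ ?_).resolve_left fun h0 => he.ne_zero ?_
  · rw [mul_assoc, ← mul_assoc p, hpq, hp]
  · rw [← mul_assoc, hq]
  · rw [mul_assoc, hp']
  · rw [← hee]
    conv_lhs => rw [← hpq]
    rw [mul_assoc, ← mul_assoc q, h0, zero_mul, mul_zero]

theorem mem_jacobson_of_forall_isNilpotent {x : Λ} (h : ∀ y, IsNilpotent (y * x)) :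
    x ∈ Ring.jacobson Λ := by
  rw [← Ideal.jacobson_bot, Ideal.mem_jacobson_iff]
  intro y
  obtain ⟨u, hu⟩ := (h y).isUnit_add_one
  refine ⟨↑u⁻¹, ?_⟩
  rw [Submodule.mem_bot, sub_eq_zero, mul_assoc, ← mul_add_one, ← hu, Units.inv_mul]

/-- Applying `e j` to the sum gives `z j = -∑ e j e i z i` over `i ≠ j`, so the span `W` of the `z
i` satisfies `W ≤ J W`, and Nakayama's lemma applies. -/
theorem eq_zero_of_mul_mem_jacobson {V : Type*} [AddCommGroup V] [Module Λ V] {ι : Type*}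
    (T : Finset ι) (e : ι → Λ) (z : ι → V) (hz : ∀ i ∈ T, e i • z i = z i)
    (hsum : ∀ j ∈ T, e j • ∑ i ∈ T, z i = 0)
    (hJ : ∀ i ∈ T, ∀ j ∈ T, i ≠ j → e j * e i ∈ Ring.jacobson Λ) : ∀ i ∈ T, z i = 0 := by
  classical
  have hW : Submodule.span Λ (z '' T) = ⊥ := by
    refine Submodule.FG.eq_bot_of_le_jacobson_smul
      (Submodule.fg_span (T.finite_toSet.image z)) (Submodule.span_le.mpr ?_)
    rintro _ ⟨j, hj, rfl⟩
    have hj : j ∈ T := hj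
    have h1 := hsum j hj
    rw [← Finset.add_sum_erase T z hj, smul_add, hz j hj, add_eq_zero_iff_eq_neg] at h1
    rw [SetLike.mem_coe, h1, Finset.smul_sum]
    refine neg_mem (sum_mem fun i hi => ?_)
    have hiT := Finset.mem_of_mem_erase hi
    rw [← hz i hiT, ← mul_smul]
    exact Submodule.smul_mem_smul (hJ i hiT j hj (Finset.ne_of_mem_erase hi))
      (Submodule.subset_span ⟨i, hiT, rfl⟩)
  intro i hi
  have : z i ∈ Submodule.span Λ (z '' T) := Submodule.subset_span ⟨i, hi, rfl⟩
  rwa [hW, Submodule.mem_bot] at this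

end RingTheory

section CommutingEnd

variable {A : Type u} [Ring A] {V : Type v} [AddCommGroup V] [Module A V] {ι : Type w}

variable (A) in
/-- The ring of endomorphisms that commute with a family of additive maps. -/
def commutingEnd (P : ι → V →+ V) : Subring (Module.End A V) where
  carrier := {φ | ∀ i v, φ (P i v) = P i (φ v)}
  mul_mem' {a b} ha hb i v := by
    rw [Module.End.mul_apply, Module.End.mul_apply, hb, ha]
  one_mem' _ _ := rfl
  add_mem' {a b} ha hb i v := by
    rw [LinearMap.add_apply, LinearMap.add_apply, ha, hb, map_add]
  zero_mem' i v := by simp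
  neg_mem' {a} ha i v := by rw [LinearMap.neg_apply, LinearMap.neg_apply, ha, map_neg]

variable {P : ι → V →+ V}

theorem exists_range_pow_eq [IsArtinianRing A] (θ : Module.End A V)
    (hθ : (LinearMap.range θ).FG) :
    ∃ n : ℕ, LinearMap.range (θ ^ (n + 1)) = LinearMap.range (θ ^ (n + 1) * θ ^ (n + 1)) := by
  have : Module.Finite A (LinearMap.range θ) := Module.Finite.iff_fg.mpr hθ
  have hanti {k l : ℕ} (hkl : k ≤ l) : LinearMap.range (θ ^ l) ≤ LinearMap.range (θ ^ k) := by
    obtain ⟨d, rfl⟩ := Nat.exists_eq_add_of_le hkl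
    rw [pow_add]
    exact LinearMap.range_comp_le_range _ _
  have hle (k : ℕ) : LinearMap.range (θ ^ (k + 1)) ≤ LinearMap.range θ := by
    simpa using hanti (Nat.le_add_left 1 k)
  obtain ⟨n, hn⟩ := IsArtinian.monotone_stabilizes (R := A) (M := LinearMap.range θ)
    ⟨fun k => OrderDual.toDual
      ((LinearMap.range (θ ^ (k + 1))).comap (LinearMap.range θ).subtype),
      fun k l hkl => Submodule.comap_mono (hanti (Nat.succ_le_succ hkl))⟩
  refine ⟨n, ?_⟩
  -- Index `k` of the chain stands for the power `k + 1`, so the square of `θ ^ (n + 1)` has index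
  -- `2 * n + 1`. Starting at power one keeps the chain inside the finitely generated range of `θ`.
  have h1 : (LinearMap.range (θ ^ (n + 1))).comap (LinearMap.range θ).subtype =
      (LinearMap.range (θ ^ (2 * n + 1 + 1))).comap (LinearMap.range θ).subtype :=
    hn (2 * n + 1) (by lia)
  rw [← pow_add, show n + 1 + (n + 1) = 2 * n + 1 + 1 by ring]
  refine le_antisymm (fun v hv => ?_) (hanti (by lia))
  have : (⟨v, hle _ hv⟩ : LinearMap.range θ) ∈
      (LinearMap.range (θ ^ (n + 1))).comap (LinearMap.range θ).subtype := hv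
  rw [h1] at this
  exact this

/-- A high power `t` of `θ` maps its finitely generated range onto itself, hence bijectively.
Inverting `t` twice on that range, after one application of `t`, yields the quasi-inverse. -/
theorem hasFittingPower [IsArtinianRing A] (θ : commutingEnd A P)
    (hθ : (LinearMap.range (θ : Module.End A V)).FG) : HasFittingPower θ := by
  obtain ⟨n, hn⟩ := exists_range_pow_eq (θ : Module.End A V) hθ
  have : Module.Finite A (LinearMap.range (θ : Module.End A V)) := Module.Finite.iff_fg.mpr hθ
  set τ : commutingEnd A P := θ ^ (n + 1) with hτ
  set t : Module.End A V := (θ : Module.End A V) ^ (n + 1) with ht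
  have htτ : (τ : Module.End A V) = t := rfl
  have htP : ∀ i v, t (P i v) = P i (t v) := fun i v => τ.2 i v
  have hZle : LinearMap.range t ≤ LinearMap.range (θ : Module.End A V) := by
    rw [ht, pow_succ']; exact LinearMap.range_comp_le_range _ _
  have hZ : Module.Finite A (LinearMap.range t) :=
    Module.Finite.iff_fg.mpr (isNoetherian_submodule.mp inferInstance _ hZle)
  let E : LinearMap.range t →ₗ[A] LinearMap.range t :=
    t.rangeRestrict.comp (LinearMap.range t).subtype
  have hE (z : LinearMap.range t) : (E z : V) = t z := rfl
  have hEs : Function.Surjective E := by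
    rintro ⟨z, hz⟩
    rw [hn] at hz
    obtain ⟨w, rfl⟩ := hz
    exact ⟨⟨t w, w, rfl⟩, rfl⟩
  have hEi : Function.Injective E := IsNoetherian.injective_of_surjective_endomorphism E hEs
  let e := LinearEquiv.ofBijective E ⟨hEi, hEs⟩
  let c : Module.End A V := (LinearMap.range t).subtype.comp
    (e.symm.toLinearMap.comp (e.symm.toLinearMap.comp t.rangeRestrict))
  have hcmem (v : V) : c v ∈ LinearMap.range t := Subtype.coe_prop _
  have hc (v : V) : t (t (c v)) = t v := by
    change ((e (e (e.symm (e.symm (t.rangeRestrict v)))) : LinearMap.range t) : V) = t v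
    simp
  -- Thus `c v` is the only element of the range of `t` with `t (t (c v)) = t v`; both commutation
  -- properties of `c` follow from this uniqueness.
  have huniq {z z' : V} (hz : z ∈ LinearMap.range t) (hz' : z' ∈ LinearMap.range t)
      (h : t (t z) = t (t z')) : z = z' := by
    have : E (E ⟨z, hz⟩) = E (E ⟨z', hz'⟩) := Subtype.ext h
    exact congrArg Subtype.val (hEi (hEi this))
  have hcP : c ∈ commutingEnd A P := by
    intro i v
    refine huniq (hcmem _) ?_ ?_
    · obtain ⟨w, hw⟩ := hcmem v
      exact ⟨P i w, by rw [htP, hw]⟩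
    · rw [hc, htP, htP, htP, hc]
  refine ⟨n, ⟨c, hcP⟩, Subtype.ext (LinearMap.ext fun v => ?_),
    Subtype.ext (LinearMap.ext fun v => ?_)⟩
  · change c (t v) = t (c v)
    exact huniq (hcmem _) ⟨_, rfl⟩ (by rw [hc, hc])
  · change t (c (t v)) = t v
    exact huniq ⟨_, rfl⟩ ⟨_, rfl⟩ (by rw [hc])

/-- A nonprimitive idempotent dominates a smaller nonzero one, whose range has strictly smaller
length. -/
theorem exists_isPrimitiveIdempotent_of_idempotent [IsArtinianRing A] (g : commutingEnd A P)
    (hg : (LinearMap.range (g : Module.End A V)).FG) (hgg : g * g = g) (hg0 : g ≠ 0) :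
    ∃ e : commutingEnd A P, IsPrimitiveIdempotent e ∧
      (LinearMap.range (e : Module.End A V)).FG := by
  induction h : Module.length A (LinearMap.range (g : Module.End A V))
    using WellFoundedLT.induction generalizing g with
  | ind l ih =>
    subst h
    have : Module.Finite A (LinearMap.range (g : Module.End A V)) := Module.Finite.iff_fg.mpr hg
    by_cases hp : IsPrimitiveIdempotent g
    · exact ⟨g, hp, hg⟩
    obtain ⟨h, hhh, hgh, hhg, h0, hne⟩ : ∃ h : commutingEnd A P, h * h = h ∧ g * h = h ∧
        h * g = h ∧ h ≠ 0 ∧ h ≠ g := by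
      by_contra! hcon
      exact hp ⟨hgg, hg0, fun h h1 h2 h3 => or_iff_not_imp_left.mpr fun h4 => hcon h h1 h2 h3 h4⟩
    have hle : LinearMap.range (h : Module.End A V) ≤ LinearMap.range (g : Module.End A V) := by
      rw [← hgh]; exact LinearMap.range_comp_le_range _ _
    have hfg : (LinearMap.range (h : Module.End A V)).FG :=
      isNoetherian_submodule.mp inferInstance _ hle
    refine ih _ ?_ h hfg hhh h0 rfl
    rw [← (Submodule.comapSubtypeEquivOfLe hle).length_eq]
    refine Submodule.length_lt fun htop => hne ?_
    rw [← hhg]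
    refine Subtype.ext (LinearMap.ext fun v => ?_)
    have hv : (g : Module.End A V) v ∈ LinearMap.range (h : Module.End A V) := by
      have : (⟨(g : Module.End A V) v, v, rfl⟩ : LinearMap.range (g : Module.End A V)) ∈
        (LinearMap.range (h : Module.End A V)).comap
          (LinearMap.range (g : Module.End A V)).subtype := htop ▸ Submodule.mem_top
      exact this
    obtain ⟨w, hw⟩ := hv
    change (h : Module.End A V) ((g : Module.End A V) v) = (g : Module.End A V) v
    rw [← hw]
    exact LinearMap.congr_fun (congrArg Subtype.val hhh) w

/-- All powers of `θ` fix `x`, so none vanishes and the Fitting idempotent is nonzero. -/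
theorem exists_isPrimitiveIdempotent [IsArtinianRing A] (θ : commutingEnd A P)
    (hθ : (LinearMap.range (θ : Module.End A V)).FG) {x : V} (hx0 : x ≠ 0)
    (hx : (θ : Module.End A V) x = x) :
    ∃ e : commutingEnd A P, IsPrimitiveIdempotent e ∧
      (LinearMap.range (e : Module.End A V)).FG := by
  have : Module.Finite A (LinearMap.range (θ : Module.End A V)) := Module.Finite.iff_fg.mpr hθ
  obtain ⟨n, c, -, hreg⟩ := hasFittingPower θ hθ
  refine exists_isPrimitiveIdempotent_of_idempotent (θ ^ (n + 1) * c) ?_ ?_ ?_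
  · refine isNoetherian_submodule.mp inferInstance _ (?_ : _ ≤ LinearMap.range (θ : Module.End A V))
    rw [pow_succ', mul_assoc]
    exact LinearMap.range_comp_le_range _ _
  · rw [← mul_assoc, hreg]
  · intro h0
    rw [h0, zero_mul] at hreg
    have hpow : ∀ k : ℕ, ((θ ^ k : commutingEnd A P) : Module.End A V) x = x := by
      intro k
      induction k with
      | zero => rfl
      | succ k ih =>
        rw [pow_succ]
        change ((θ ^ k : commutingEnd A P) : Module.End A V) ((θ : Module.End A V) x) = x
        rw [hx, ih]
    exact hx0 (by rw [← hpow (n + 1), ← hreg]; rfl)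

end CommutingEnd
end

/-! ### Graded endomorphisms of the pull-up and their shifts -/

noncomputable section

theorem isNilpotent_mul_swap {Λ : Type*} [Ring Λ] {x y : Λ} (h : IsNilpotent (x * y)) :
    IsNilpotent (y * x) := by
  obtain ⟨n, hn⟩ := h
  have key : ∀ k : ℕ, (y * x) ^ (k + 1) = y * (x * y) ^ k * x := by
    intro k
    induction k with
    | zero => simp
    | succ k ih => rw [pow_succ, ih, pow_succ]; simp only [mul_assoc]
  exact ⟨n + 1, by rw [key, hn, mul_zero, zero_mul]⟩

theorem IsPrimitiveIdempotent.map {Λ : Type*} [Ring Λ] {e : Λ} (he : IsPrimitiveIdempotent e)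
    (f : Λ ≃+* Λ) : IsPrimitiveIdempotent (f e) where
  mul_self := by rw [← map_mul, he.mul_self]
  ne_zero h := he.ne_zero (f.injective (by rw [h, map_zero]))
  eq_zero_or_eq g hg h1 h2 := by
    obtain ⟨g, rfl⟩ := f.surjective g
    rw [← map_mul] at hg h1 h2
    rcases he.eq_zero_or_eq g (f.injective hg) (f.injective h1) (f.injective h2) with h | h
    · exact Or.inl (by rw [h, map_zero])
    · exact Or.inr (by rw [h])

namespace PullUp

variable {R : Type u} [Ring R] (𝓐 : ℤ → AddSubgroup R) (N : Type v) [AddCommGroup N]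

/-- The projection of the pull-up to its component of degree `n`. -/
def homogeneousProj (n : ℤ) : PullUp 𝓐 N →+ PullUp 𝓐 N := (of 𝓐 N n).comp (coeff n)

variable {𝓐 N}

theorem homogeneousProj_apply (n : ℤ) (v : PullUp 𝓐 N) :
    homogeneousProj 𝓐 N n v = of 𝓐 N n (coeff n v) := rfl

@[simp] theorem homogeneousProj_of (n : ℤ) (x : N) :
    homogeneousProj 𝓐 N n (of 𝓐 N n x) = of 𝓐 N n x := by
  rw [homogeneousProj_apply, coeff_of_same]

variable [GradedRing 𝓐] [Module Rᵐᵒᵖ N]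

variable (𝓐 N) in
/-- The ring of degree-preserving endomorphisms of the pull-up. -/
abbrev gradedEnd : Subring (Module.End Rᵐᵒᵖ (PullUp 𝓐 N)) :=
  commutingEnd Rᵐᵒᵖ (homogeneousProj 𝓐 N)

variable (𝓐 N) in
/-- The grading of the pull-up. -/
def coaction : Coaction 𝓐 (PullUp 𝓐 N) :=
  Coaction.ofProj (homogeneousProj 𝓐 N)
    (fun v => by
      obtain ⟨T, h0, h1⟩ := exists_support v
      exact ⟨T, fun n hn => by rw [homogeneousProj_apply, h0 n hn, map_zero], h1⟩)
    (fun n v => homogeneousProj_of n _)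
    (fun n k h v => by rw [homogeneousProj_apply, homogeneousProj_apply, coeff_of_ne h, map_zero])
    (fun j r hr n v => by
      rw [homogeneousProj_apply, homogeneousProj_apply, coeff_smul hr, op_smul_of 𝓐 N hr])

theorem coaction_proj (n : ℤ) (v : PullUp 𝓐 N) :
    (coaction 𝓐 N).proj n v = homogeneousProj 𝓐 N n v :=
  Coaction.ofProj_proj ..

theorem homogeneousProj_shift (k n : ℤ) (v : PullUp 𝓐 N) :
    homogeneousProj 𝓐 N n (shift k v) = shift k (homogeneousProj 𝓐 N (n - k) v) := by
  rw [homogeneousProj_apply, homogeneousProj_apply, coeff_shift, shift_of, sub_add_cancel]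

theorem shift_shift_neg (k : ℤ) (v : PullUp 𝓐 N) : shift k (shift (-k) v) = v := by
  rw [shift_shift, neg_add_cancel, shift_zero, LinearMap.id_apply]

theorem shift_neg_shift (k : ℤ) (v : PullUp 𝓐 N) : shift (-k) (shift k v) = v := by
  rw [shift_shift, add_neg_cancel, shift_zero, LinearMap.id_apply]

/-- Conjugation of a degree-preserving endomorphism by a shift. -/
def shiftConj (k : ℤ) (φ : gradedEnd 𝓐 N) : gradedEnd 𝓐 N :=
  ⟨(shift (-k)).comp ((φ : Module.End Rᵐᵒᵖ (PullUp 𝓐 N)).comp (shift k)), fun n v => by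
    simp only [LinearMap.comp_apply]
    rw [homogeneousProj_shift, sub_neg_eq_add, ← φ.2, homogeneousProj_shift, add_sub_cancel_right]⟩

theorem shiftConj_apply (k : ℤ) (φ : gradedEnd 𝓐 N) (v : PullUp 𝓐 N) :
    (shiftConj k φ : Module.End Rᵐᵒᵖ (PullUp 𝓐 N)) v =
      shift (-k) ((φ : Module.End Rᵐᵒᵖ (PullUp 𝓐 N)) (shift k v)) := rfl

variable (𝓐 N) in
/-- Conjugation by a shift as an automorphism of the ring of degree-preserving endomorphisms. -/
def shiftConjEquiv (k : ℤ) : gradedEnd 𝓐 N ≃+* gradedEnd 𝓐 N where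
  toFun := shiftConj k
  invFun := shiftConj (-k)
  left_inv φ := Subtype.ext (LinearMap.ext fun v => by
    simp only [shiftConj_apply, neg_neg, shift_shift_neg])
  right_inv φ := Subtype.ext (LinearMap.ext fun v => by
    simp only [shiftConj_apply, neg_neg, shift_neg_shift])
  map_mul' φ ψ := Subtype.ext (LinearMap.ext fun v => by
    change shift (-k) ((φ : Module.End Rᵐᵒᵖ (PullUp 𝓐 N)) ((ψ : Module.End Rᵐᵒᵖ (PullUp 𝓐 N))
      (shift k v))) = shift (-k) ((φ : Module.End Rᵐᵒᵖ (PullUp 𝓐 N)) (shift k (shift (-k)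
        ((ψ : Module.End Rᵐᵒᵖ (PullUp 𝓐 N)) (shift k v)))))
    rw [shift_shift_neg])
  map_add' φ ψ := Subtype.ext (LinearMap.ext fun v => map_add (shift (-k)) _ _)

theorem range_shiftConj_le (k : ℤ) (φ : gradedEnd 𝓐 N) :
    LinearMap.range (shiftConj k φ : Module.End Rᵐᵒᵖ (PullUp 𝓐 N)) ≤
      (LinearMap.range (φ : Module.End Rᵐᵒᵖ (PullUp 𝓐 N))).map (shift (-k)) := by
  rintro _ ⟨v, rfl⟩
  exact ⟨_, ⟨shift k v, rfl⟩, rfl⟩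

theorem range_mul_le (φ ψ : gradedEnd 𝓐 N) :
    LinearMap.range ((φ * ψ : gradedEnd 𝓐 N) : Module.End Rᵐᵒᵖ (PullUp 𝓐 N)) ≤
      LinearMap.range (φ : Module.End Rᵐᵒᵖ (PullUp 𝓐 N)) :=
  LinearMap.range_comp_le_range _ _

theorem proj_mem_range (e : gradedEnd 𝓐 N) (n : ℤ) :
    ∀ y ∈ LinearMap.range (e : Module.End Rᵐᵒᵖ (PullUp 𝓐 N)),
      (coaction 𝓐 N).proj n y ∈ LinearMap.range (e : Module.End Rᵐᵒᵖ (PullUp 𝓐 N)) := by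
  rintro _ ⟨v, rfl⟩
  rw [coaction_proj, ← e.2]
  exact ⟨_, rfl⟩

/-- The homogeneous components of finitely many generators are finite in number and generate a
suitable submodule. -/
theorem exists_fg_homogeneous_hull {Y : Submodule Rᵐᵒᵖ (PullUp 𝓐 N)} (hY : Y.FG) :
    ∃ H : Submodule Rᵐᵒᵖ (PullUp 𝓐 N), H.FG ∧ ∀ y ∈ Y, ∀ n, of 𝓐 N n (coeff n y) ∈ H := by
  classical
  obtain ⟨G, rfl⟩ := hY
  choose T hT0 hT using fun v : PullUp 𝓐 N => exists_support v
  refine ⟨Submodule.span Rᵐᵒᵖ (G.biUnion fun g => (T g).image fun n => of 𝓐 N n (coeff n g) :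
    Finset (PullUp 𝓐 N)), ⟨_, rfl⟩, fun y hy => ?_⟩
  induction hy using Submodule.span_induction with
  | mem g hg =>
    intro n
    by_cases hn : n ∈ T g
    · exact Submodule.subset_span (Finset.mem_biUnion.mpr ⟨g, hg, Finset.mem_image_of_mem _ hn⟩)
    · rw [hT0 g n hn, map_zero]; exact zero_mem _
  | zero => simp
  | add a b _ _ ha hb => intro n; rw [map_add, map_add]; exact add_mem (ha n) (hb n)
  | smul s y _ hy =>
    obtain ⟨r, rfl⟩ := MulOpposite.op_surjective s
    induction r using DirectSum.Decomposition.inductionOn 𝓐 with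
    | zero => simp
    | add a b ha hb =>
      intro n
      rw [MulOpposite.op_add, add_smul, map_add, map_add]
      exact add_mem (ha n) (hb n)
    | @homogeneous j a =>
      intro n
      have := op_smul_of 𝓐 N a.2 (n - j) (coeff (n - j) y)
      rw [sub_add_cancel, ← coeff_smul' a.2] at this
      rw [← this]
      exact Submodule.smul_mem _ _ (hy _)

variable [IsArtinianRing Rᵐᵒᵖ]

theorem fg_of_le {Y Y' : Submodule Rᵐᵒᵖ (PullUp 𝓐 N)} (h : Y ≤ Y') (hY' : Y'.FG) : Y.FG := by
  have : Module.Finite Rᵐᵒᵖ Y' := Module.Finite.iff_fg.mpr hY'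
  exact isNoetherian_submodule.mp inferInstance _ h

section Primitive

variable {e : gradedEnd 𝓐 N}

theorem finite_support_range (hfg : (LinearMap.range (e : Module.End Rᵐᵒᵖ (PullUp 𝓐 N))).FG) :
    {n | ∃ v, homogeneousProj 𝓐 N n ((e : Module.End Rᵐᵒᵖ (PullUp 𝓐 N)) v) ≠ 0}.Finite := by
  have : Module.Finite Rᵐᵒᵖ (LinearMap.range (e : Module.End Rᵐᵒᵖ (PullUp 𝓐 N))) :=
    Module.Finite.iff_fg.mpr hfg
  refine ((coaction 𝓐 N).restrict _ (proj_mem_range e)).finite_support.subset ?_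
  rintro n ⟨v, hv⟩
  refine ⟨⟨_, v, rfl⟩, fun h0 => hv ?_⟩
  have := congrArg Subtype.val h0
  rwa [Coaction.coe_restrict_proj, coaction_proj] at this

/-- A factorization of the `i`-th conjugate through the `j`-th forces the support of `e` into itself
under translation by `j - i`; a finite nonempty set admits only the zero translation. -/
theorem eq_of_shiftConj_iso (he : e ≠ 0)
    (hfg : (LinearMap.range (e : Module.End Rᵐᵒᵖ (PullUp 𝓐 N))).FG) {i j : ℤ}
    {p q : gradedEnd 𝓐 N} (hpq : p * q = shiftConj i e) (hq : shiftConj j e * q = q) : i = j := by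
  obtain ⟨k, hk⟩ : ∃ k, k ∈
      {n | ∃ v, homogeneousProj 𝓐 N n ((e : Module.End Rᵐᵒᵖ (PullUp 𝓐 N)) v) ≠ 0} := by
    by_contra! hcon
    refine he (Subtype.ext (LinearMap.ext fun v => (coaction 𝓐 N).ext fun n => ?_))
    have := hcon n
    simp only [Set.mem_ofPred_eq, not_exists, not_not] at this
    rw [coaction_proj, this]
    exact (map_zero _).symm
  have hmem (n : ℤ) (φ : gradedEnd 𝓐 N) (l : ℤ) (v : PullUp 𝓐 N) :
      homogeneousProj 𝓐 N n ((shiftConj l φ : Module.End Rᵐᵒᵖ (PullUp 𝓐 N)) v) =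
        shift (-l) (homogeneousProj 𝓐 N (n + l)
          ((φ : Module.End Rᵐᵒᵖ (PullUp 𝓐 N)) (shift l v))) := by
    rw [shiftConj_apply, homogeneousProj_shift, sub_neg_eq_add]
  have hstep (n : ℤ) (hn : n ∈ {n | ∃ v, homogeneousProj 𝓐 N n
      ((e : Module.End Rᵐᵒᵖ (PullUp 𝓐 N)) v) ≠ 0}) :
      n + (j - i) ∈ {n | ∃ v, homogeneousProj 𝓐 N n
        ((e : Module.End Rᵐᵒᵖ (PullUp 𝓐 N)) v) ≠ 0} := by
    obtain ⟨v, hv⟩ := hn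
    refine ⟨shift j ((q : Module.End Rᵐᵒᵖ (PullUp 𝓐 N)) (shift (-i) v)), fun h0 => hv ?_⟩
    have h1 := hmem (n - i) e j ((q : Module.End Rᵐᵒᵖ (PullUp 𝓐 N)) (shift (-i) v))
    rw [show n - i + j = n + (j - i) by ring, h0, map_zero] at h1
    have h2 : homogeneousProj 𝓐 N (n - i)
        ((q : Module.End Rᵐᵒᵖ (PullUp 𝓐 N)) (shift (-i) v)) = 0 := by
      rw [← h1]
      conv_lhs => rw [← hq]
      rfl
    have h3 := hmem (n - i) e i (shift (-i) v)
    rw [← hpq, shift_shift_neg, sub_add_cancel] at h3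
    have h4 : homogeneousProj 𝓐 N (n - i) (((p * q : gradedEnd 𝓐 N) :
        Module.End Rᵐᵒᵖ (PullUp 𝓐 N)) (shift (-i) v)) = 0 := by
      change homogeneousProj 𝓐 N (n - i) ((p : Module.End Rᵐᵒᵖ (PullUp 𝓐 N))
        ((q : Module.End Rᵐᵒᵖ (PullUp 𝓐 N)) (shift (-i) v))) = 0
      rw [← p.2, h2, map_zero]
    rw [← shift_shift_neg i (homogeneousProj 𝓐 N n _), ← h3, h4, map_zero]
  have := Int.eq_zero_of_forall_add_mul_mem (finite_support_range hfg) (k := k) (d := j - i)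
    fun l => by
      induction l with
      | zero => simpa using hk
      | succ l ih =>
        have := hstep _ ih
        rwa [show k + ((l + 1 : ℕ) : ℤ) * (j - i) = k + l * (j - i) + (j - i) by push_cast; ring]
  lia

/-- Write `e_i` for the conjugate of `e` by the shift by `i`. For any `y`, the element `e_i y e_j
e_i` is nilpotent, since the alternative is an isomorphism of distinct shifts. Cyclic permutation
makes `y e_j e_i` nilpotent as well. -/
theorem shiftConj_mul_mem_jacobson (he : IsPrimitiveIdempotent e)
    (hfg : (LinearMap.range (e : Module.End Rᵐᵒᵖ (PullUp 𝓐 N))).FG) {i j : ℤ} (hij : i ≠ j) :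
    shiftConj j e * shiftConj i e ∈ Ring.jacobson (gradedEnd 𝓐 N) := by
  have hprim (k : ℤ) : IsPrimitiveIdempotent (shiftConj k e) := he.map (shiftConjEquiv 𝓐 N k)
  refine mem_jacobson_of_forall_isNilpotent fun y => ?_
  have hfit : HasFittingPower (shiftConj i e * y * shiftConj j e * 1 * shiftConj i e) := by
    refine hasFittingPower _ (fg_of_le (Y' := (LinearMap.range
      (e : Module.End Rᵐᵒᵖ (PullUp 𝓐 N))).map (shift (-i))) ?_ (hfg.map _))
    simp only [mul_assoc]
    exact (range_mul_le _ _).trans (range_shiftConj_le i e)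
  rcases (hprim i).isNilpotent_or_exists_iso (hprim j) y 1 hfit with h | h
  · have h' : IsNilpotent (shiftConj i e * (y * (shiftConj j e * shiftConj i e))) := by
      simpa only [mul_assoc, one_mul] using h
    have := isNilpotent_mul_swap h'
    rwa [mul_assoc, mul_assoc, (hprim i).mul_self] at this
  · obtain ⟨p, q, hpq, -, -, -, hq, -⟩ := h
    exact absurd (eq_of_shiftConj_iso he.ne_zero hfg hpq hq) hij

/-- A primitive degree-preserving idempotent of the pull-up with finitely generated range gives a
nonzero gradable direct summand of the module. -/
theorem exists_retraction_of_isPrimitiveIdempotent (he : IsPrimitiveIdempotent e)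
    (hfg : (LinearMap.range (e : Module.End Rᵐᵒᵖ (PullUp 𝓐 N))).FG) :
    ∃ g : N →ₗ[Rᵐᵒᵖ] LinearMap.range (e : Module.End Rᵐᵒᵖ (PullUp 𝓐 N)),
      ∀ y : LinearMap.range (e : Module.End Rᵐᵒᵖ (PullUp 𝓐 N)), g (counit 𝓐 N y) = y := by
  classical
  have hfin : Module.Finite Rᵐᵒᵖ (LinearMap.range (e : Module.End Rᵐᵒᵖ (PullUp 𝓐 N))) :=
    Module.Finite.iff_fg.mpr hfg
  set E : Module.End Rᵐᵒᵖ (PullUp 𝓐 N) := e.1 with hE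
  have hEE (v : PullUp 𝓐 N) : E (E v) = E v :=
    LinearMap.congr_fun (congrArg Subtype.val he.mul_self) v
  have hEof (n : ℤ) (x : N) : E (of 𝓐 N n x) = of 𝓐 N n (coeff n (E (of 𝓐 N n x))) := by
    rw [← homogeneousProj_apply, ← e.2, homogeneousProj_of]
  have hD := finite_support_range hfg
  have hzero (n : ℤ) (hn : n ∉ hD.toFinset) (x : N) : E (of 𝓐 N n x) = 0 := by
    rw [hEof, ← homogeneousProj_apply]
    by_contra h
    exact hn (hD.mem_toFinset.mpr ⟨_, h⟩)
  let ρ₀ : N →+ PullUp 𝓐 N := ∑ n ∈ hD.toFinset, E.toAddMonoidHom.comp (of 𝓐 N n)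
  have hρ₀ (x : N) : ρ₀ x = ∑ n ∈ hD.toFinset, E (of 𝓐 N n x) := by
    simp [ρ₀, AddMonoidHom.finsetSum_apply]
  -- This holds even for `k` outside the support, where both sides vanish; the finite index set
  -- therefore plays no role in the proof of linearity.
  have hcoeff (x : N) (k : ℤ) : coeff k (ρ₀ x) = coeff k (E (of 𝓐 N k x)) := by
    rw [hρ₀, map_sum]
    by_cases hk : k ∈ hD.toFinset
    · refine Finset.sum_eq_single_of_mem k hk fun n _ hn => ?_
      rw [hEof, coeff_of_ne hn]
    · rw [hzero k hk, map_zero]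
      refine Finset.sum_eq_zero fun n hn => ?_
      rw [hEof, coeff_of_ne]
      rintro rfl
      exact hk hn
  let ρ : N →ₗ[Rᵐᵒᵖ] PullUp 𝓐 N := linearMapOfHomogeneous 𝓐 ρ₀ fun j r hr x => by
    refine PullUp.ext fun k => ?_
    rw [hcoeff, coeff_smul' hr, hcoeff, ← coeff_smul hr, ← map_smul, op_smul_of 𝓐 N hr,
      sub_add_cancel]
  have hρ (x : N) : ρ x = ρ₀ x := rfl
  let ρ' : N →ₗ[Rᵐᵒᵖ] LinearMap.range E := ρ.codRestrict _ fun x => by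
    rw [hρ, hρ₀]
    exact sum_mem fun n _ => ⟨_, rfl⟩
  let b : LinearMap.range E →ₗ[Rᵐᵒᵖ] LinearMap.range E :=
    ρ'.comp ((counit 𝓐 N).comp (LinearMap.range E).subtype)
  have hinj : Function.Injective b := by
    rw [← LinearMap.ker_eq_bot, LinearMap.ker_eq_bot']
    rintro ⟨y, hy⟩ hby
    have hby : ρ (counit 𝓐 N y) = 0 := congrArg Subtype.val hby
    have hEy : E y = y := by
      obtain ⟨v, rfl⟩ := hy
      exact hEE v
    obtain ⟨T, hT0, hT⟩ := exists_support y
    have hz (n : ℤ) : E (of 𝓐 N n (coeff n y)) = of 𝓐 N n (coeff n y) := by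
      rw [← homogeneousProj_apply, e.2, ← hE, hEy]
    -- All coefficients of `y` are moved to degree `0`, where they sum to `(counit y) e₀`. The
    -- `i`-th conjugate of `e` fixes the `i`-th term, and the `j`-th kills the sum because the
    -- coefficient of `ρ (counit y)` in degree `j` is zero.
    have hvan := eq_zero_of_mul_mem_jacobson T (fun i => shiftConj i e)
      (fun i => of 𝓐 N 0 (coeff i y))
      (fun i _ => by
        change shift (-i) (E (shift i (of 𝓐 N 0 (coeff i y)))) = _
        rw [shift_of, zero_add, hz, shift_of, add_neg_cancel])
      (fun j _ => by
        change shift (-j) (E (shift j (∑ i ∈ T, of 𝓐 N 0 (coeff i y)))) = 0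
        rw [← map_sum, shift_of, zero_add]
        have h1 : ∑ i ∈ T, coeff i y = counit 𝓐 N y := by
          conv_rhs => rw [hT]
          simp
        rw [h1, hEof, ← hcoeff, ← hρ, hby, map_zero, map_zero, map_zero])
      (fun i _ j _ hij => shiftConj_mul_mem_jacobson he hfg hij)
    refine Subtype.ext (PullUp.ext fun n => ?_)
    change coeff n y = coeff n 0
    rw [map_zero]
    by_cases hn : n ∈ T
    · exact of_injective 0 (by rw [hvan n hn, map_zero])
    · exact hT0 n hn
  let β := LinearEquiv.ofBijective b
    ⟨hinj, IsArtinian.surjective_of_injective_endomorphism b hinj⟩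
  exact ⟨β.symm.toLinearMap.comp ρ', fun y => β.symm_apply_apply y⟩

end Primitive

/-! ### A primitive idempotent from pure-projectivity -/

theorem exists_isPrimitiveIdempotent_of_isPureProjective [Nontrivial N]
    (h : IsPureProjective Rᵐᵒᵖ (PullUp 𝓐 N)) :
    ∃ e : gradedEnd 𝓐 N, IsPrimitiveIdempotent e ∧
      (LinearMap.range (e : Module.End Rᵐᵒᵖ (PullUp 𝓐 N))).FG := by
  classical
  obtain ⟨κ, F, _, _, hF, i, s, hsi⟩ := h
  obtain ⟨x, hx⟩ := exists_ne (0 : N)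
  -- Cutting the splitting down to the finitely many summands that meet the image of `x e₀` gives an
  -- endomorphism with finitely generated range that still fixes `x e₀`.
  let T : Finset κ := DFinsupp.support (i (of 𝓐 N 0 x))
  let τ : (⨁ k, F k) →ₗ[Rᵐᵒᵖ] ⨁ k, F k :=
    ∑ k ∈ T, (DirectSum.lof Rᵐᵒᵖ κ F k).comp (DirectSum.component Rᵐᵒᵖ κ F k)
  let θ' : Module.End Rᵐᵒᵖ (PullUp 𝓐 N) := s.comp (τ.comp i)
  have hτ (w : ⨁ k, F k) : τ w = ∑ k ∈ T, DirectSum.lof Rᵐᵒᵖ κ F k (w k) := by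
    simp [τ, LinearMap.sum_apply, DirectSum.apply_eq_component Rᵐᵒᵖ]
  have hθ'x : θ' (of 𝓐 N 0 x) = of 𝓐 N 0 x := by
    have h1 : τ (i (of 𝓐 N 0 x)) = i (of 𝓐 N 0 x) := by
      rw [hτ]
      exact DirectSum.sum_support_of (i (of 𝓐 N 0 x))
    change s (τ (i _)) = _
    rw [h1]
    exact LinearMap.congr_fun hsi _
  have hθ'fg : (LinearMap.range θ').FG := by
    refine fg_of_le (Y' := ⨆ k ∈ T, LinearMap.range (s.comp (DirectSum.lof Rᵐᵒᵖ κ F k))) ?_ ?_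
    · rintro _ ⟨v, rfl⟩
      change s (τ (i v)) ∈ _
      rw [hτ, map_sum]
      exact sum_mem fun k hk => Submodule.mem_iSup_of_mem k (Submodule.mem_iSup_of_mem hk ⟨_, rfl⟩)
    · refine Submodule.fg_biSup _ _ fun k _ => ?_
      rw [LinearMap.range_eq_map]
      exact Module.Finite.fg_top.map _
  -- The degree-zero part may leave the range of `θ'`, but its values on homogeneous elements are
  -- homogeneous components of elements of that range.
  obtain ⟨H, hH, hmem⟩ := exists_fg_homogeneous_hull hθ'fg
  have hθ : degreeZeroPart θ' ∈ gradedEnd 𝓐 N := by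
    intro n v
    induction v using induction with
    | zero => simp
    | add v w hv hw => simp only [map_add, hv, hw]
    | of m y =>
      rw [degreeZeroPart_of, homogeneousProj_apply, homogeneousProj_apply, coeff_of, coeff_of]
      split_ifs with h
      · subst h; rw [degreeZeroPart_of]
      · simp
  refine exists_isPrimitiveIdempotent (⟨degreeZeroPart θ', hθ⟩ : gradedEnd 𝓐 N)
    (fg_of_le (Y' := H) ?_ hH) (x := of 𝓐 N 0 x) ?_ ?_
  · rintro _ ⟨v, rfl⟩
    change degreeZeroPart θ' v ∈ H
    induction v using induction with
    | zero => simp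
    | add v w hv hw => rw [map_add]; exact add_mem hv hw
    | of m y =>
      rw [degreeZeroPart_of]
      exact hmem _ ⟨_, rfl⟩ _
  · exact fun h => hx (of_injective 0 (by rw [h, map_zero]))
  · change degreeZeroPart θ' (of 𝓐 N 0 x) = _
    rw [degreeZeroPart_of, hθ'x, coeff_of_same]

end PullUp

end

/-! ### Splitting off graded summands, and the equivalence -/

noncomputable section

open PullUp

variable {R : Type u} [Ring R] {𝓐 : ℤ → AddSubgroup R} [GradedRing 𝓐]

section

variable {N : Type v} [AddCommGroup N] [Module Rᵐᵒᵖ N]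

theorem IsPureProjective.of_retract {S : Type u} [Ring S] {M M' : Type w} [AddCommGroup M]
    [Module S M] [AddCommGroup M'] [Module S M'] (h : IsPureProjective S M)
    (f : M' →ₗ[S] M) (g : M →ₗ[S] M') (hgf : ∀ x, g (f x) = x) : IsPureProjective S M' := by
  obtain ⟨ι, F, i1, i2, hF, i, s, hsi⟩ := h
  refine ⟨ι, F, i1, i2, hF, i.comp f, g.comp s, LinearMap.ext fun x => ?_⟩
  have := LinearMap.congr_fun hsi (f x)
  simp only [LinearMap.comp_apply, LinearMap.id_apply] at this ⊢
  rw [this, hgf]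

theorem isPureProjective_finsupp {S : Type u} [Ring S] [IsNoetherianRing S] {M : Type w}
    [AddCommGroup M] [Module S M] [Module.Finite S M] : IsPureProjective S (ℕ →₀ M) := by
  classical
  obtain ⟨n, f, hf⟩ := Module.Finite.exists_fin' S M
  -- The definition wants summands in the universe of `S`; a quotient of `Sⁿ` is a copy of `M`
  -- there.
  let e : ((Fin n → S) ⧸ LinearMap.ker f) ≃ₗ[S] M := f.quotKerEquivOfSurjective hf
  let E : (ULift.{w} ℕ →₀ ((Fin n → S) ⧸ LinearMap.ker f)) ≃ₗ[S] (ℕ →₀ M) :=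
    Finsupp.lcongr Equiv.ulift e
  let D : (ULift.{w} ℕ →₀ ((Fin n → S) ⧸ LinearMap.ker f)) ≃ₗ[S]
      ⨁ _ : ULift.{w} ℕ, ((Fin n → S) ⧸ LinearMap.ker f) := finsuppLEquivDirectSum S _ _
  exact ⟨ULift.{w} ℕ, fun _ => (Fin n → S) ⧸ LinearMap.ker f, inferInstance, inferInstance,
    fun _ => Module.finitePresentation_of_finite _ _,
    (E.symm.trans D).toLinearMap, (E.symm.trans D).symm.toLinearMap,
    LinearMap.ext fun x => (E.symm.trans D).symm_apply_apply x⟩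

/-- The grading of a module with a graded direct summand and a graded complement. -/
def Coaction.ofRetraction {X : Type w} [AddCommGroup X] [Module Rᵐᵒᵖ X] (c : Coaction 𝓐 X)
    (f : X →ₗ[Rᵐᵒᵖ] N) (g : N →ₗ[Rᵐᵒᵖ] X) (hgf : ∀ x, g (f x) = x)
    (c' : Coaction 𝓐 (LinearMap.ker g)) : Coaction 𝓐 N :=
  let q : N →ₗ[Rᵐᵒᵖ] LinearMap.ker g := (LinearMap.id - f.comp g).codRestrict _ fun x => by
    simp [hgf]
  have hq (x : N) : (q x : N) = x - f (g x) := rfl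
  have hqf (x : X) : q (f x) = 0 := Subtype.ext (by rw [hq, hgf, sub_self]; rfl)
  have hqs (x : LinearMap.ker g) : q x = x := Subtype.ext (by
    rw [hq, LinearMap.mem_ker.mp x.2, map_zero, sub_zero])
  { hom := (PullUp.map f).comp (c.hom.comp g) +
      (PullUp.map (LinearMap.ker g).subtype).comp (c'.hom.comp q)
    counit_hom := fun m => by
      simp [c.counit_hom, c'.counit_hom, hq]
    hom_coeff_hom := fun n m => by
      have hk (x : LinearMap.ker g) : g x = 0 := x.2
      simp [c.coeff_hom, c'.coeff_hom, hgf, hqf, hqs, hk, c.hom_proj, c'.hom_proj] }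

/-- Each primitive idempotent splits a nonzero graded summand off `N`. The pull-up is functorial, so
the complement `ker g` inherits pure-projectivity, and the two gradings add up. -/
theorem nonempty_coaction_of_isPureProjective [IsArtinianRing Rᵐᵒᵖ] [Module.Finite Rᵐᵒᵖ N]
    (h : IsPureProjective Rᵐᵒᵖ (PullUp 𝓐 N)) : Nonempty (Coaction 𝓐 N) := by
  induction hl : Module.length Rᵐᵒᵖ N using WellFoundedLT.induction generalizing N with
  | ind l ih =>
    subst hl
    rcases subsingleton_or_nontrivial N with hN | hN
    · exact ⟨⟨0, fun _ => Subsingleton.elim _ _, fun n m => by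
        rw [Subsingleton.elim (coeff n _) (0 : N), map_zero, map_zero]⟩⟩
    obtain ⟨e, he, hfg⟩ := exists_isPrimitiveIdempotent_of_isPureProjective h
    obtain ⟨g, hg⟩ := exists_retraction_of_isPrimitiveIdempotent he hfg
    let c := (coaction 𝓐 N).restrict _ (proj_mem_range e)
    let f : LinearMap.range (e : Module.End Rᵐᵒᵖ (PullUp 𝓐 N)) →ₗ[Rᵐᵒᵖ] N :=
      (counit 𝓐 N).comp (Submodule.subtype _)
    have hgf : ∀ x, g (f x) = x := hg
    -- If `g = 0`, the retraction identity would make the range of `e` zero; this is what makes the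
    -- length drop.
    have hker : LinearMap.ker g ≠ ⊤ := by
      intro htop
      refine he.ne_zero (Subtype.ext (LinearMap.ext fun v => ?_))
      have h1 := hgf ⟨_, v, rfl⟩
      rw [LinearMap.ker_eq_top.mp htop] at h1
      exact (congrArg Subtype.val h1).symm
    let q : N →ₗ[Rᵐᵒᵖ] LinearMap.ker g := (LinearMap.id - f.comp g).codRestrict _ fun x => by
      simp [hgf]
    have hq (x : LinearMap.ker g) : q x = x := Subtype.ext (by
      change (x : N) - f (g x) = x
      rw [LinearMap.mem_ker.mp x.2, map_zero, sub_zero])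
    have hpp : IsPureProjective Rᵐᵒᵖ (PullUp 𝓐 (LinearMap.ker g)) :=
      h.of_retract (PullUp.map (LinearMap.ker g).subtype) (PullUp.map q) fun v =>
        PullUp.ext fun n => by simp [hq]
    obtain ⟨c'⟩ := ih _ (Submodule.length_lt hker) hpp rfl
    exact ⟨c.ofRetraction f g hgf c'⟩

end

end

theorem theorem3 {R : Type u} [Ring R] (𝓐 : ℤ → AddSubgroup R) [GradedRing 𝓐]
    [IsArtinianRing Rᵐᵒᵖ] (N : Type v) [AddCommGroup N] [Module Rᵐᵒᵖ N] [Module.Finite Rᵐᵒᵖ N] :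
    List.TFAE [IsGradable 𝓐 N,
      IsPureProjective Rᵐᵒᵖ (PullUp 𝓐 N),
      Nonempty (PullUp 𝓐 N ≃ₗ[Rᵐᵒᵖ] (ℕ →₀ N))] := by
  tfae_have 1 → 3 := by
    rintro ⟨M, _, _, ℳ, hℳ, ⟨e⟩⟩
    obtain ⟨d⟩ : Nonempty (ℤ ≃ ℕ) := nonempty_equiv_of_countable
    let E : PullUp 𝓐 N ≃ₗ[Rᵐᵒᵖ] PullUp 𝓐 M := LinearEquiv.ofLinearMap (PullUp.map e.toLinearMap)
      (PullUp.map e.symm.toLinearMap) (PullUp.linearMap_ext fun n x => by simp)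
      (PullUp.linearMap_ext fun n x => by simp)
    exact ⟨E.trans ((Coaction.ofGrading hℳ).equivPullUp.symm.trans (Finsupp.lcongr d e.symm))⟩
  tfae_have 3 → 2 := by
    rintro ⟨e⟩
    exact isPureProjective_finsupp.of_retract e.toLinearMap e.symm.toLinearMap e.symm_apply_apply
  tfae_have 2 → 1 := fun h =>
    (nonempty_coaction_of_isPureProjective h).elim fun c => c.isGradable
  tfae_finish
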